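/- Let $K$ be an algebraically closed field of characteristic $p\ge 0$, and write $\mathbb T^n=(K^\times)^n$. Let $f,g\in K(t)^\times$ be rational functions that are not both constant, let $\rho:\mathbb T^1\dashrightarrow\mathbb T^2$ be the rational map $t\mapsto(f(t),g(t))$, and let $C=\overline{\rho(\mathbb T^1)}\subset\mathbb T^2$ be the Zariski closure of its image. A defining equation of $C$ is an irreducible Laurent polynomial $E_C\in K[x^{\pm1},y^{\pm1}]$ whose zero set in $\mathbb T^2$ is $C$; its Newton polygon $N(C)\subset\mathbb R^2$ is the convex hull of the exponents of the monomials of $E_C$. For a non-empty compact convex set $Q\subset\mathbb R^2$ put $h(Q;w)=\max\{\langle w,u\rangle: u\in Q\}$. For non-zero integers $\sigma_1,\sigma_2$ let $G(\sigma)$ be the Zariski closure in $\mathbb T^1\times\mathbb T^2$ of the set $\{(t,x,y): x^{\sigma_1}=f(t),\ y^{\sigma_2}=g(t)\}$, let $\pi:\mathbb T^1\times\mathbb T^2\to\mathbb T^2$ be the projection $(t,x,y)\mapsto(x,y)$, and let $C(\sigma)=\overline{\pi(G(\sigma))}\subset\mathbb T^2$. The degree of $\rho$, respectively of $\pi|_{G(\sigma)}$,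 is the cardinality of its fibre above a generic point of the Zariski closure of its image (that is, above every point of some dense open subset). The degree $\deg(Z)$ of a pure one-dimensional algebraic set $Z\subset\mathbb T^2$ is the number of points of $Z$ on a generic line $\ell_0+\ell_1x+\ell_2y=0$. Let $\sigma_1,\sigma_2\in\mathbb Z\setminus p\mathbb Z$ (that is, non-zero integers if $p=0$). Then the degrees of $\rho$ and of $\pi|_{G(\sigma)}$ are well defined and $$\deg(\pi|_{G(\sigma)})=\deg(\rho).$$ Moreover $C$ has a defining equation, and for every defining equation $E_C$ of $C$, with Newton polygon $N(C)$, $$h(N(C);(\sigma_1,\sigma_2))+h(N(C);(-\sigma_1,0))+h(N(C);(0,-\sigma_2))=\deg(C(\sigma)),$$ where the degree $\deg(C(\sigma))$ is well defined. -/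

import Mathlib

namespace RationalCurve

/-- The algebraic torus `(Kˣ)ⁿ`. -/
abbrev Torus (K : Type*) [Field K] (n : ℕ) : Type _ := Fin n → Kˣ

/-- Laurent polynomials in `n` variables over `K`: the group algebra of `ℤⁿ`. -/
abbrev Laurent (K : Type*) [Field K] (n : ℕ) : Type _ := AddMonoidAlgebra K (Fin n → ℤ)

section Zariski

variable {K : Type*} [Field K] {n : ℕ}

/-- The value `F(z) = ∑ₘ Fₘ zᵐ` of a Laurent polynomial at a point of the torus. -/
noncomputable def laurentEval (F : Laurent K n) (z : Torus K n) : K :=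
  ∑ m ∈ F.coeff.support, F.coeff m * ((∏ i, z i ^ m i : Kˣ) : K)

/-- The set `V(I)` of common zeros in the torus. -/
def zeroLocus (I : Set (Laurent K n)) : Set (Torus K n) :=
  {z | ∀ F ∈ I, laurentEval F z = 0}

/-- The set of all Laurent polynomials which vanish on `S`. -/
def vanishing (S : Set (Torus K n)) : Set (Laurent K n) :=
  {F | ∀ z ∈ S, laurentEval F z = 0}

def IsZariskiClosed (Z : Set (Torus K n)) : Prop :=
  ∃ I : Set (Laurent K n), Z = zeroLocus I

/-- The Zariski closure: the smallest Zariski closed set containing `S`. -/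
def zariskiClosure (S : Set (Torus K n)) : Set (Torus K n) :=
  zeroLocus (vanishing S)

/-- `U` is a (relatively) open and dense subset of `Z`. -/
def IsDenseOpenIn (U Z : Set (Torus K n)) : Prop :=
  (∃ W, IsZariskiClosed W ∧ U = Z \ W) ∧ Z ⊆ zariskiClosure U

/-- `φ` has degree `d`: above a generic point of the Zariski closure of its image, the fibre
has exactly `d` points. -/
def MapHasDegree {X : Type*} (φ : X → Torus K n) (d : ℕ) : Prop :=
  ∃ U, IsDenseOpenIn U (zariskiClosure (Set.range φ)) ∧
    ∀ q ∈ U, (φ ⁻¹' {q}).encard = d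

/-- A subset `Z` of the two-dimensional torus has degree `d` with respect to the inclusion
`(x, y) ↦ (1 : x : y)` in the projective plane: a generic line
`ℓ₀ w + ℓ₁ x + ℓ₂ y = 0` meets `Z` in exactly `d` points. Generic means: for all coefficients
outside the zero set of some non-zero polynomial. -/
def CurveHasDegree (Z : Set (Torus K 2)) (d : ℕ) : Prop :=
  ∃ P : MvPolynomial (Fin 3) K, P ≠ 0 ∧ ∀ l : Fin 3 → K, MvPolynomial.eval l P ≠ 0 →
    {z ∈ Z | l 0 + l 1 * (z 0 : K) + l 2 * (z 1 : K) = 0}.encard = d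

/-- `E` is a defining equation of the irreducible plane curve `C`: an irreducible Laurent
polynomial whose zero set is `C`. -/
def IsDefiningEquation (E : Laurent K 2) (C : Set (Torus K 2)) : Prop :=
  Irreducible E ∧ zeroLocus {E} = C

/-- The Newton polygon: the convex hull in `ℝ²` of the exponents of the monomials of `E`. -/
def newtonPolygon (E : Laurent K 2) : Set (Fin 2 → ℝ) :=
  convexHull ℝ ((fun (m : Fin 2 → ℤ) (i : Fin 2) => (m i : ℝ)) '' (E.coeff.support : Set (Fin 2 → ℤ)))

end Zariski

/-- The support function `h(Q; w) = max {⟨w, u⟩ : u ∈ Q}` (the supremum is a maximum for a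
non-empty compact set `Q`, such as the Newton polygon of a non-zero Laurent polynomial). -/
noncomputable def supportFn (Q : Set (Fin 2 → ℝ)) (w : Fin 2 → ℝ) : ℝ :=
  sSup ((fun u => w ⬝ᵥ u) '' Q)

section Parametrization

variable {K : Type*} [Field K]

/-- `f` has neither a zero nor a pole at `t` (numerator and denominator of a `RatFunc` are
coprime). -/
def IsUnitAt (f : RatFunc K) (t : K) : Prop :=
  f.num.eval t ≠ 0 ∧ f.denom.eval t ≠ 0

/-- The value `f(t)` of `f` at a point which is neither a zero nor a pole. -/
noncomputable def unitValue (f : RatFunc K) (t : K) (h : IsUnitAt f t) : Kˣ :=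
  Units.mk0 (f.num.eval t / f.denom.eval t) (div_ne_zero h.1 h.2)

/-- The domain of the rational map `t ↦ (f(t), g(t))` from the one-dimensional to the
two-dimensional torus. -/
def RhoDomain (f g : RatFunc K) : Type _ :=
  {t : Kˣ // IsUnitAt f (t : K) ∧ IsUnitAt g (t : K)}

/-- The rational map `ρ : t ↦ (f(t), g(t))` on its domain. -/
noncomputable def rho (f g : RatFunc K) (t : RhoDomain f g) : Torus K 2 :=
  ![unitValue f (t.1 : K) t.2.1, unitValue g (t.1 : K) t.2.2]

/-- The curve `C`: the Zariski closure of the image of `ρ`. -/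
noncomputable def curve (f g : RatFunc K) : Set (Torus K 2) :=
  zariskiClosure (Set.range (rho f g))

/-- `G(σ)`: the Zariski closure of the set of all `(t, x, y)` in the three-dimensional torus
with `x ^ σ₁ = f(t)` and `y ^ σ₂ = g(t)`. -/
noncomputable def coverGraph (f g : RatFunc K) (s₁ s₂ : ℤ) : Set (Torus K 3) :=
  zariskiClosure {z | ∃ t : RhoDomain f g, z 0 = t.1 ∧
    z 1 ^ s₁ = rho f g t 0 ∧ z 2 ^ s₂ = rho f g t 1}

/-- The projection `π : (t, x, y) ↦ (x, y)`. -/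
def proj (z : Torus K 3) : Torus K 2 := ![z 1, z 2]

/-- `C(σ)`: the Zariski closure of `π(G(σ))`. -/
noncomputable def coverCurve (f g : RatFunc K) (s₁ s₂ : ℤ) : Set (Torus K 2) :=
  zariskiClosure (proj '' coverGraph f g s₁ s₂)

end Parametrization

end RationalCurve

/-!
Write `φ` for the endomorphism `(x, y) ↦ (x ^ s₁, y ^ s₂)` of the torus (`powMap`) and `ρ` for the
parametrization. The set `G(σ)` consists exactly of the `(t, x, y)` with `φ(x, y) = ρ(t)`
(`coverGraph_eq`), so its projection to the plane is the preimage under `φ` of the image of `ρ`, and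
the fibre of the projection above `q` is the fibre of `ρ` above `φ(q)` (`encard_fiber_proj`). As the
exponents are prime to the characteristic, taking preimages under `φ` commutes with Zariski closure
(`zariskiClosure_preimage_powMap`): a Laurent polynomial that vanishes on a preimage is split into
its isotypic parts under the kernel of `φ`, which vanish separately by the linear independence of
characters. Hence `C(σ)` is the preimage of `C`, and the equality of the two degrees follows once
`ρ` has a degree.

For the degree of `ρ`, a resultant shows that `ρ` misses only finitely many points of `C`
(`finite_curve_diff_range`). For all but finitely many `s` the fibre of `ρ` through `s` consists of
the zeros `t` of a greatest common divisor of `f(t) - f(s)` and `g(t) - g(s)`, cleared of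
denominators. The number of zeros of a bivariate polynomial `D(s, ·)` is the same for almost all `s`
(`exists_generic_fiber_card`), also in the inseparable case. The resultant has an irreducible factor
that vanishes on the image of `ρ`. It defines `C`, because two plane curves without common component
have finitely many points in common (`finite_common_zeros`).

For the last formula, `C(σ)` is the zero set of `E(x ^ s₁, y ^ s₂)`. After division by the
largest monomial that divides it this becomes a polynomial `Q` whose total degree is the left-hand
side of the formula. It has no multiple component: `E` has only finitely many singular points, and
`φ` is étale. Therefore a suitable line meets `Q = 0` transversally in as many points as the degree
says (`exists_transversal_line`), and by the non-vanishing of a discriminant so does a generic line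
(`curveHasDegree_of_totalDegree`).
-/

namespace RationalCurve

open Polynomial
open scoped Polynomial.Bivariate

/-! ### Roots of univariate polynomials -/

section Univariate

variable {K : Type*} [Field K] [IsAlgClosed K]

theorem exists_common_root_of_not_isCoprime {f g : K[X]} (h : ¬ IsCoprime f g) :
    ∃ t, f.eval t = 0 ∧ g.eval t = 0 := by
  by_contra! hc
  exact h ((isCoprime_iff_aeval_ne_zero_of_isAlgClosed K K f g).2 fun a ↦ by
    by_cases hf : f.eval a = 0
    · exact Or.inr (by simpa using hc a hf)
    · exact Or.inl (by simpa using hf))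

/-- A polynomial all of whose roots are simple has as many roots as its degree. -/
theorem encard_roots_of_simple {q : K[X]} (hq : q ≠ 0)
    (h : ∀ y, q.eval y = 0 → q.derivative.eval y ≠ 0) :
    {y | q.eval y = 0}.encard = q.natDegree := by
  classical
  have hsep : q.Separable := by
    by_contra hc
    obtain ⟨t, h1, h2⟩ := exists_common_root_of_not_isCoprime hc
    exact h t h1 h2
  have : {y | q.eval y = 0} = (q.roots.toFinset : Set K) := by
    ext y; simp [hq]
  rw [this, Set.encard_coe_eq_coe_finsetCard, Multiset.toFinset_card_of_nodup (nodup_roots hsep),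
    (IsAlgClosed.splits q).natDegree_eq_card_roots]

end Univariate

/-! ### Polynomials in two variables -/

section Bivariate

variable {K : Type*} [Field K]

theorem finite_eval_eq_zero {r : K[X]} (hr : r ≠ 0) : {x | r.eval x = 0}.Finite := by
  classical
  refine (r.roots.toFinset.finite_toSet).subset fun x hx ↦ ?_
  simpa [hr] using hx

theorem evalEval_eq_eval_map (P : K[X][Y]) (x y : K) :
    P.evalEval x y = (P.map (evalRingHom x)).eval y :=
  (map_evalRingHom_eval x y P).symm

theorem C_X_sub_C_dvd {P : K[X][Y]} {x : K} (h : P.map (evalRingHom x) = 0) :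
    C (X - C x) ∣ P := by
  rw [C_dvd_iff_dvd_coeff]
  intro i
  rw [dvd_iff_isRoot]
  have := congrArg (fun p ↦ p.coeff i) h
  simpa using this

theorem finite_fiber {P : K[X][Y]} {x : K} (h : ¬ C (X - C x) ∣ P) :
    {y | P.evalEval x y = 0}.Finite := by
  have : P.map (evalRingHom x) ≠ 0 := fun h0 ↦ h (C_X_sub_C_dvd h0)
  simpa only [evalEval_eq_eval_map] using finite_eval_eq_zero this

/-- Elimination of the second variable. -/
theorem exists_eliminant {P Q : K[X][Y]} (hP : Irreducible P) (hd : P.natDegree ≠ 0)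
    (hPQ : ¬ P ∣ Q) : ∃ (u v : K[X][Y]) (r : K[X]), r ≠ 0 ∧ u * P + v * Q = C r := by
  have hprim := hP.isPrimitive hd
  let F := FractionRing K[X]
  have hinj : Function.Injective (algebraMap K[X] F) := IsFractionRing.injective _ _
  have hirr : Irreducible (P.map (algebraMap K[X] F)) :=
    (hprim.irreducible_iff_irreducible_map_fraction_map (K := F)).1 hP
  have hnd : ¬ P.map (algebraMap K[X] F) ∣ Q.map (algebraMap K[X] F) := fun h ↦
    hPQ (hprim.dvd_of_fraction_map_dvd_fraction_map (K := F) h)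
  obtain ⟨a, b, hab⟩ := (hirr.coprime_iff_not_dvd).2 hnd
  obtain ⟨c, hc, hca⟩ := IsLocalization.integerNormalization_spec (nonZeroDivisors K[X]) a
  obtain ⟨d, hd', hdb⟩ := IsLocalization.integerNormalization_spec (nonZeroDivisors K[X]) b
  refine ⟨C d * IsLocalization.integerNormalization (nonZeroDivisors K[X]) a,
    C c * IsLocalization.integerNormalization (nonZeroDivisors K[X]) b, c * d, ?_, ?_⟩
  · exact mul_ne_zero (nonZeroDivisors.ne_zero hc) (nonZeroDivisors.ne_zero hd')
  · apply Polynomial.map_injective _ hinj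
    simp only [Polynomial.map_add, Polynomial.map_mul, Polynomial.map_C, hca, hdb, map_mul,
      Algebra.smul_def, Polynomial.algebraMap_apply]
    linear_combination (C (algebraMap K[X] F c) * C (algebraMap K[X] F d)) * hab


theorem not_C_X_sub_C_dvd {P : K[X][Y]} (hP : Irreducible P) (hd : P.natDegree ≠ 0) (x : K) :
    ¬ C (X - C x) ∣ P := fun h ↦
  not_isUnit_X_sub_C x (hP.isPrimitive hd _ h)

theorem finite_common_zeros_of_irreducible {P Q : K[X][Y]} (hP : Irreducible P) (hPQ : ¬ P ∣ Q) :
    {z : K × K | P.evalEval z.1 z.2 = 0 ∧ Q.evalEval z.1 z.2 = 0}.Finite := by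
  by_cases hd : P.natDegree = 0
  · obtain ⟨h, rfl⟩ := natDegree_eq_zero.1 hd
    have h0 : h ≠ 0 := by rintro rfl; exact hP.ne_zero (by simp)
    have hirr : Irreducible h := by
      refine ⟨fun hu ↦ hP.not_isUnit (hu.map C), fun a b hab ↦ ?_⟩
      simpa [isUnit_C] using hP.isUnit_or_isUnit (a := C a) (b := C b) (by rw [hab, C_mul])
    refine ((finite_eval_eq_zero h0).biUnion (t := fun x ↦ (fun y ↦ (x, y)) ''
      {y | Q.evalEval x y = 0}) fun x hx ↦ (finite_fiber fun hdvd ↦ hPQ ?_).image _).subset ?_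
    · have h1 : X - C x ∣ h := dvd_iff_isRoot.2 hx
      have h2 := (hirr.dvd_iff.1 h1).resolve_left (not_isUnit_X_sub_C x)
      exact ((h2.map C).dvd.trans hdvd)
    · rintro ⟨x, y⟩ ⟨h1, h2⟩
      simp only [Set.mem_iUnion]
      exact ⟨x, by simpa [evalEval_C] using h1, y, h2, rfl⟩
  · obtain ⟨u, v, r, hr, huv⟩ := exists_eliminant hP hd hPQ
    refine ((finite_eval_eq_zero hr).biUnion (t := fun x ↦ (fun y ↦ (x, y)) ''
      {y | P.evalEval x y = 0}) fun x hx ↦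
        (finite_fiber (not_C_X_sub_C_dvd hP hd x)).image _).subset ?_
    rintro ⟨x, y⟩ ⟨h1, h2⟩
    simp only [Set.mem_iUnion]
    refine ⟨x, ?_, y, h1, rfl⟩
    have := congrArg (evalEval x y) huv
    simp only [evalEval_add, evalEval_mul, evalEval_C] at this
    simp only at h1 h2
    simpa [h1, h2] using this.symm

/-- Two plane curves without a common component meet in finitely many points. -/
theorem finite_common_zeros {P Q : K[X][Y]} (h : IsRelPrime P Q) :
    {z : K × K | P.evalEval z.1 z.2 = 0 ∧ Q.evalEval z.1 z.2 = 0}.Finite := by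
  have aux : ∀ {U : K[X][Y]}, IsUnit U → ∀ z : K × K, U.evalEval z.1 z.2 ≠ 0 := by
    intro U hU z hz
    have := hU.map (evalEvalRingHom z.1 z.2)
    rw [coe_evalEvalRingHom, hz] at this
    exact not_isUnit_zero this
  induction P using UniqueFactorizationMonoid.induction_on_prime with
  | h₁ =>
    have hQ : IsUnit Q := isRelPrime_zero_left.1 h
    exact Set.finite_empty.subset fun z hz ↦ aux hQ z hz.2
  | h₂ x hx => exact Set.finite_empty.subset fun z hz ↦ aux hx z hz.1
  | h₃ a p ha hp ih =>
    have h1 : ¬ p ∣ Q := fun hpQ ↦ hp.not_isUnit (h (dvd_mul_right p a) hpQ)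
    refine ((finite_common_zeros_of_irreducible hp.irreducible h1).union
      (ih (h.of_mul_left_right))).subset fun z hz ↦ ?_
    have h2 := hz.1
    rw [evalEval_mul, mul_eq_zero] at h2
    exact h2.imp (fun h3 ↦ ⟨h3, hz.2⟩) fun h3 ↦ ⟨h3, hz.2⟩

/-- A polynomial that vanishes on a product of two infinite sets is zero. -/
theorem eq_zero_of_evalEval_eq_zero {P : K[X][Y]} {S T : Set K} (hS : S.Infinite)
    (hT : T.Infinite) (h : ∀ x ∈ S, ∀ y ∈ T, P.evalEval x y = 0) : P = 0 := by
  ext1 i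
  refine eq_zero_of_infinite_isRoot _ (hS.mono fun x hx ↦ ?_)
  have h0 : P.map (evalRingHom x) = 0 := eq_zero_of_infinite_isRoot _ (hT.mono fun y hy ↦ by
    simpa [IsRoot, ← evalEval_eq_eval_map] using h x hx y hy)
  have := congrArg (fun p ↦ p.coeff i) h0
  simpa using this

/-- The derivative with respect to the first variable. -/
noncomputable def derivX (P : K[X][Y]) : K[X][Y] :=
  Bivariate.swap (derivative (Bivariate.swap P))

theorem derivative_eq_zero_of_dvd {R : Type*} [CommRing R] [IsDomain R] {P : R[X]}
    (h : P ∣ derivative P) : derivative P = 0 := by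
  by_contra h0
  have h1 := natDegree_le_of_dvd h h0
  have h2 : P.natDegree ≠ 0 := fun h3 ↦ h0 (derivative_of_natDegree_zero h3)
  exact absurd (natDegree_derivative_lt h2) (not_lt.2 h1)

theorem derivX_eq_zero_of_dvd {P : K[X][Y]} (h : P ∣ derivX P) : derivX P = 0 := by
  have h1 : Bivariate.swap P ∣ derivative (Bivariate.swap P) := by
    have := map_dvd (Bivariate.swap (R := K)) h
    rwa [derivX, Bivariate.swap_swap_apply] at this
  rw [derivX, derivative_eq_zero_of_dvd h1, map_zero]

theorem derivX_add (P Q : K[X][Y]) : derivX (P + Q) = derivX P + derivX Q := by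
  simp [derivX]

theorem derivX_monomial (i j : ℕ) (c : K) :
    derivX (monomial j (monomial i c)) = monomial j (monomial (i - 1) (c * i)) := by
  rw [derivX, Bivariate.swap_monomial_monomial, derivative_monomial]
  have : monomial j c * (i : K[X]) = monomial j (c * i) := by
    rw [← C_eq_natCast, monomial_mul_C]
  rw [this, Bivariate.swap_monomial_monomial]

/-! ### The generic number of zeros in a fibre -/

section Fibers

/-- Two polynomials without common factor have no common zero above a generic `x`. -/
theorem finite_fst_common_zeros {P Q : K[X][Y]} (h : IsRelPrime P Q) :
    {x | ∃ y, P.evalEval x y = 0 ∧ Q.evalEval x y = 0}.Finite :=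
  ((finite_common_zeros h).image Prod.fst).subset fun x ⟨y, hy⟩ ↦ ⟨(x, y), hy, rfl⟩

variable [IsAlgClosed K]

theorem exists_generic_fiber_card_of_prime (n : ℕ) : ∀ {P : K[X][Y]}, P.natDegree ≤ n → Prime P →
    ∃ d : ℕ, {x | {y | P.evalEval x y = 0}.encard ≠ d}.Finite := by
  induction n using Nat.strong_induction_on with
  | _ n ih =>
  intro P hn hP
  by_cases hd : P.natDegree = 0
  · obtain ⟨h, rfl⟩ := natDegree_eq_zero.1 hd
    have h0 : h ≠ 0 := by rintro rfl; exact hP.ne_zero (by simp)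
    refine ⟨0, (finite_eval_eq_zero h0).subset fun x hx ↦ ?_⟩
    by_contra hc
    exact hx (by simpa [evalEval_C, Set.eq_empty_iff_forall_notMem] using hc)
  by_cases hder : derivative P = 0
  · -- the inseparable case: `P(x, y) = Q(x, y ^ p)` and `y ↦ y ^ p` is bijective
    obtain ⟨p, hp⟩ := ExpChar.exists K
    have hpP := expand_contract' p hder
    cases hp with
    | zero => exact absurd (derivative_eq_zero.1 hder) hd
    | prime hp =>
      have hlt : (contract p P).natDegree < P.natDegree := by
        conv_rhs => rw [← hpP, natDegree_expand]
        refine lt_mul_of_one_lt_right (Nat.pos_of_ne_zero fun h0 ↦ hd ?_) hp.one_lt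
        rw [← hpP, natDegree_expand, h0, zero_mul]
      have hirr : Irreducible (contract p P) :=
        of_irreducible_expand hp.ne_zero (by rw [hpP]; exact hP.irreducible)
      obtain ⟨d, hfin⟩ := ih _ (lt_of_lt_of_le hlt hn) le_rfl hirr.prime
      refine ⟨d, hfin.subset fun x hx ↦ ?_⟩
      have : Fact p.Prime := ⟨hp⟩
      have h1 : (fun y : K ↦ y ^ p) '' {y | P.evalEval x y = 0} =
          {y | (contract p P).evalEval x y = 0} := by
        ext y
        have key : ∀ t, P.evalEval x t = (contract p P).evalEval x (t ^ p) := fun t ↦ by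
          conv_lhs => rw [← hpP]
          rw [evalEval_eq_eval_map, evalEval_eq_eval_map, map_expand, expand_eval]
        constructor
        · rintro ⟨t, ht, rfl⟩
          simpa [key] using ht
        · intro hy
          obtain ⟨t, rfl⟩ := IsAlgClosed.exists_pow_nat_eq y hp.pos
          exact ⟨t, by simpa [key] using hy, rfl⟩
      have h2 : Function.Injective (fun y : K ↦ y ^ p) := frobenius_inj K p
      simp only [Set.mem_ofPred_eq, ne_eq] at hx ⊢
      rwa [← h1, h2.encard_image]
  · have hnd : ¬ P ∣ derivative P := fun h ↦ hder (derivative_eq_zero_of_dvd h)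
    have hrel : IsRelPrime P (derivative P) :=
      hP.irreducible.isRelPrime_iff_not_dvd.2 hnd
    have hlead : P.leadingCoeff ≠ 0 := by simpa using hP.ne_zero
    refine ⟨P.natDegree, ((finite_fst_common_zeros hrel).union
      (finite_eval_eq_zero hlead)).subset fun x hx ↦ ?_⟩
    by_contra hc
    simp only [Set.mem_union, Set.mem_ofPred_eq, not_or, not_exists, not_and] at hc
    have hdeg : (P.map (evalRingHom x)).natDegree = P.natDegree :=
      natDegree_map_of_leadingCoeff_ne_zero _ hc.2
    refine hx ?_
    rw [← hdeg]
    simp only [evalEval_eq_eval_map]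
    refine encard_roots_of_simple (fun h0 ↦ ?_) fun y hy ↦ ?_
    · rw [h0] at hdeg; exact hd (by simpa using hdeg.symm)
    · rw [derivative_map, ← evalEval_eq_eval_map]
      exact hc.1 y (by rwa [evalEval_eq_eval_map])

/-- The number of zeros of `D(x, ·)` is the same for all but finitely many `x`. -/
theorem exists_generic_fiber_card {D : K[X][Y]} (hD : D ≠ 0) :
    ∃ d : ℕ, {x | {y | D.evalEval x y = 0}.encard ≠ d}.Finite := by
  revert hD
  induction D using UniqueFactorizationMonoid.induction_on_coprime with
  | h0 => exact fun h ↦ absurd rfl h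
  | h1 hx =>
    refine fun _ ↦ ⟨0, Set.finite_empty.subset fun x hx' ↦ hx' ?_⟩
    simp only [Nat.cast_zero, Set.encard_eq_zero, Set.eq_empty_iff_forall_notMem]
    intro y hy
    have := hx.map (evalEvalRingHom x y)
    rw [coe_evalEvalRingHom, hy] at this
    exact not_isUnit_zero this
  | hpr i hp =>
    intro _
    rcases Nat.eq_zero_or_pos i with rfl | hi
    · exact ⟨0, by simp⟩
    · obtain ⟨d, hd⟩ := exists_generic_fiber_card_of_prime _ le_rfl hp
      refine ⟨d, ?_⟩
      simpa [evalEval_pow, hi.ne'] using hd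
  | hcp hrel ih1 ih2 =>
    rename_i D₁ D₂
    intro h
    obtain ⟨d₁, hd₁⟩ := ih1 (left_ne_zero_of_mul h)
    obtain ⟨d₂, hd₂⟩ := ih2 (right_ne_zero_of_mul h)
    refine ⟨d₁ + d₂, ((hd₁.union hd₂).union (finite_fst_common_zeros hrel)).subset
      fun x hx ↦ ?_⟩
    by_contra hc
    simp only [Set.mem_union, Set.mem_ofPred_eq, not_or, not_not, not_exists, not_and] at hc
    refine hx ?_
    have h1 : {y | (D₁ * D₂).evalEval x y = 0} =
        {y | D₁.evalEval x y = 0} ∪ {y | D₂.evalEval x y = 0} := by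
      ext y; simp [evalEval_mul]
    rw [h1, Set.encard_union_eq, hc.1.1, hc.1.2]
    · norm_cast
    · rw [Set.disjoint_left]
      exact fun y hy hy' ↦ hc.2 y hy hy'

end Fibers

end Bivariate

/-! ### Resultants and common roots -/

section Resultant

variable {K : Type*} [Field K]

theorem resultant_eq_zero_of_common_root {f g : K[X]} {m n : ℕ} (hf : f.natDegree ≤ m)
    (hg : g.natDegree ≤ n) (hmn : m ≠ 0 ∨ n ≠ 0) {t : K} (h1 : f.eval t = 0)
    (h2 : g.eval t = 0) : f.resultant g m n = 0 := by
  obtain ⟨p, q, -, -, h⟩ := exists_mul_add_mul_eq_C_resultant f g hf hg hmn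
  have := congrArg (eval t) h
  simpa [h1, h2] using this.symm

variable [IsAlgClosed K]

/-- If the resultant with respect to formal degrees vanishes, then there is a common root, or
else both formal leading coefficients vanish. -/
theorem exists_common_root_of_resultant_eq_zero {f g : K[X]} {m n : ℕ} (hf : f.natDegree ≤ m)
    (hg : g.natDegree ≤ n) (h : f.resultant g m n = 0) :
    (∃ t, f.eval t = 0 ∧ g.eval t = 0) ∨ (f.coeff m = 0 ∧ g.coeff n = 0) := by
  have key : ∀ {f g : K[X]} {m n : ℕ}, f.natDegree ≤ m → g.natDegree ≤ n →
      f.resultant g m n = 0 → f.coeff m ≠ 0 → ∃ t, f.eval t = 0 ∧ g.eval t = 0 := by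
    intro f g m n hf hg h hm
    have hfm : f.natDegree = m := le_antisymm hf (le_natDegree_of_ne_zero hm)
    obtain ⟨k, rfl⟩ := Nat.exists_eq_add_of_le hg
    rw [resultant_add_right_deg _ _ _ _ _ le_rfl, mul_eq_zero, ← hfm] at h
    have h1 := h.resolve_left (pow_ne_zero _ (by rwa [hfm]))
    exact exists_common_root_of_not_isCoprime (resultant_eq_zero_iff.1 h1).2
  by_cases h1 : f.coeff m = 0
  · by_cases h2 : g.coeff n = 0
    · exact Or.inr ⟨h1, h2⟩
    · rw [resultant_comm, mul_eq_zero] at h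
      obtain ⟨t, ht⟩ := key hg hf (h.resolve_left (pow_ne_zero _ (by simp))) h2
      exact Or.inl ⟨t, ht.symm⟩
  · exact Or.inl (key hf hg h h1)

end Resultant

/-! ### Intersecting a plane curve with a generic line -/

section Lines

variable {K : Type*} [Field K]

/-- The restriction of the plane curve `Q = 0` to the line `y = a + b x`. -/
noncomputable def restrictLine (Q : K[X][Y]) (a b : K) : K[X] := Q.eval (C a + C b * X)

theorem eval_restrictLine (Q : K[X][Y]) (a b x : K) :
    (restrictLine Q a b).eval x = Q.evalEval x (a + b * x) := by
  induction Q using Polynomial.induction_on' with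
  | add p q hp hq => simp_all [restrictLine, evalEval_add]
  | monomial n r =>
    simp [restrictLine, evalEval, eval_monomial]

theorem derivative_restrictLine (Q : K[X][Y]) (a b : K) :
    derivative (restrictLine Q a b) =
      restrictLine (derivX Q + C (C b) * derivative Q) a b := by
  induction Q using Polynomial.induction_on' with
  | add p q hp hq =>
    simp only [restrictLine, eval_add, derivative_add, derivX_add, eval_mul, eval_C] at hp hq ⊢
    rw [hp, hq]; ring
  | monomial j r =>
    induction r using Polynomial.induction_on' with
    | add p q hp hq =>
      simp only [restrictLine, eval_add, derivX_add, eval_mul, eval_C, map_add] at hp hq ⊢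
      rw [hp, hq]; ring
    | monomial i c =>
      rw [derivX_monomial, derivative_monomial]
      simp only [restrictLine, eval_add, eval_mul, eval_monomial, eval_C]
      simp only [← C_mul_X_pow_eq_monomial, derivative_mul, derivative_pow, derivative_add,
        derivative_C, derivative_X, map_mul, map_natCast]
      ring

/-- The homogeneous version of `restrictLine`: the restriction of `Q = 0` to the line
`l₀ + l₁ x + l₂ y = 0`, multiplied by `l₂ ^ d`, with indeterminate coefficients `l₀, l₁, l₂`. -/
noncomputable def restrictGenericLine (Q : K[X][Y]) (d : ℕ) : (MvPolynomial (Fin 3) K)[X] :=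
  ∑ j ∈ Finset.range (d + 1), (Q.coeff j).map MvPolynomial.C *
    (-(C (MvPolynomial.X 0) + C (MvPolynomial.X 1) * X) : (MvPolynomial (Fin 3) K)[X]) ^ j *
      C (MvPolynomial.X 2 ^ (d - j))

/-- The polynomial `Q` has total degree at most `d`. -/
def TotalDegreeLE (Q : K[X][Y]) (d : ℕ) : Prop :=
  ∀ i j, (Q.coeff j).coeff i ≠ 0 → i + j ≤ d

theorem TotalDegreeLE.natDegree_coeff_le {Q : K[X][Y]} {d : ℕ} (h : TotalDegreeLE Q d) (j : ℕ) :
    (Q.coeff j).natDegree ≤ d - j := by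
  refine natDegree_le_iff_coeff_eq_zero.2 fun i hi ↦ ?_
  by_contra hc
  have := h i j hc
  omega

theorem TotalDegreeLE.natDegree_le {Q : K[X][Y]} {d : ℕ} (h : TotalDegreeLE Q d) :
    Q.natDegree ≤ d := by
  refine natDegree_le_iff_coeff_eq_zero.2 fun j hj ↦ ?_
  by_contra hc
  obtain ⟨i, hi⟩ : ∃ i, (Q.coeff j).coeff i ≠ 0 := by
    by_contra! h0
    exact hc (Polynomial.ext (by simpa using h0))
  have := h i j hi
  omega

theorem map_restrictGenericLine {Q : K[X][Y]} {d : ℕ} (h : TotalDegreeLE Q d) {l : Fin 3 → K}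
    (hl : l 2 ≠ 0) : (restrictGenericLine Q d).map (MvPolynomial.eval l) =
      C (l 2 ^ d) * restrictLine Q (-l 0 / l 2) (-l 1 / l 2) := by
  rw [restrictGenericLine, restrictLine,
    eval_eq_sum_range' (Nat.lt_succ_of_le h.natDegree_le), Finset.mul_sum, Polynomial.map_sum]
  refine Finset.sum_congr rfl fun j hj ↦ ?_
  have hj' : j ≤ d := Nat.lt_succ_iff.1 (Finset.mem_range.1 hj)
  have h1 : ((Q.coeff j).map MvPolynomial.C).map (MvPolynomial.eval l) = Q.coeff j := by
    rw [Polynomial.map_map]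
    convert! Polynomial.map_id
    ext; simp
  have h2 : (C (-l 0 / l 2) + C (-l 1 / l 2) * X : K[X]) =
      C (l 2)⁻¹ * (-(C (l 0) + C (l 1) * X)) := by
    simp only [div_eq_mul_inv, C_mul, C_neg]; ring
  have h3 : (C (l 2 ^ d) : K[X]) * C (l 2)⁻¹ ^ j = C (l 2 ^ (d - j)) := by
    rw [← C_pow, ← C_mul, inv_pow, pow_sub₀ _ hl hj']
  simp only [Polynomial.map_mul, h1, Polynomial.map_pow, Polynomial.map_neg, Polynomial.map_add,
    Polynomial.map_C, Polynomial.map_X, map_pow, MvPolynomial.eval_X, h2, mul_pow] at h3 ⊢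
  rw [← h3]; ring

theorem natDegree_restrictGenericLine_le {Q : K[X][Y]} {d : ℕ} (h : TotalDegreeLE Q d) :
    (restrictGenericLine Q d).natDegree ≤ d := by
  refine natDegree_sum_le_of_forall_le (Finset.range (d + 1)) _ fun j hj ↦ ?_
  have hj' : j ≤ d := Nat.lt_succ_iff.1 (Finset.mem_range.1 hj)
  refine (natDegree_mul_C_le _ _).trans (natDegree_mul_le.trans ?_)
  have h1 := (natDegree_map_le (f := (MvPolynomial.C : K →+* MvPolynomial (Fin 3) K))
    (p := Q.coeff j)).trans (h.natDegree_coeff_le j)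
  have h2 : ((-(C (MvPolynomial.X 0) + C (MvPolynomial.X 1) * X) :
      (MvPolynomial (Fin 3) K)[X]) ^ j).natDegree ≤ j * 1 := by
    refine natDegree_pow_le_of_le j ?_
    rw [natDegree_neg]; compute_degree
  omega

theorem coeff_restrictLine {Q : K[X][Y]} {d : ℕ} (h : TotalDegreeLE Q d) (a b : K) :
    (restrictLine Q a b).coeff d =
      (∑ j ∈ Finset.range (d + 1), C ((Q.coeff j).coeff (d - j)) * X ^ j : K[X]).eval b := by
  rw [restrictLine, eval_eq_sum_range' (Nat.lt_succ_of_le h.natDegree_le), finsetSum_coeff,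
    eval_finsetSum]
  refine Finset.sum_congr rfl fun j hj ↦ ?_
  have hj' : j ≤ d := Nat.lt_succ_iff.1 (Finset.mem_range.1 hj)
  have h1 : (C a + C b * X : K[X]).natDegree ≤ 1 := by compute_degree
  have h2 := coeff_mul_add_eq_of_natDegree_le (h.natDegree_coeff_le j)
    (natDegree_pow_le_of_le j h1)
  rw [mul_one, Nat.sub_add_cancel hj'] at h2
  have h3 := coeff_pow_of_natDegree_le (m := j) h1
  rw [mul_one] at h3
  rw [h2, h3]
  simp

/-- If no component of the curve `Q = 0` is singular at each of its points, then for all but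
finitely many slopes `b` the curve has no common component with its polar curve. -/
theorem finite_not_isRelPrime_polar {Q : K[X][Y]} (hQ : Q ≠ 0)
    (hsing : ∀ H, Irreducible H → H ∣ Q → H ∣ derivX Q → ¬ H ∣ derivative Q) :
    {b : K | ¬ IsRelPrime Q (derivX Q + C (C b) * derivative Q)}.Finite := by
  classical
  refine ((UniqueFactorizationMonoid.factors Q).toFinset.finite_toSet.biUnion
    (t := fun H ↦ {b : K | H ∣ derivX Q + C (C b) * derivative Q}) fun H hH ↦ ?_).subset ?_
  · have hH' := Multiset.mem_toFinset.1 hH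
    refine Set.Subsingleton.finite fun b hb b' hb' ↦ ?_
    by_contra hne
    have h1 : H ∣ C (C (b - b')) * derivative Q := by
      have := dvd_sub hb hb'
      rw [add_sub_add_left_eq_sub, ← sub_mul, ← C_sub, ← C_sub] at this
      exact this
    have hu : IsUnit (C (C (b - b')) : K[X][Y]) :=
      ((isUnit_iff_ne_zero.2 (sub_ne_zero.2 hne)).map C).map C
    have h2 : H ∣ derivative Q := (hu.dvd_mul_left).1 h1
    exact hsing H (UniqueFactorizationMonoid.irreducible_of_factor H hH')
      (UniqueFactorizationMonoid.dvd_of_mem_factors hH')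
      ((dvd_add_left (h2.mul_left _)).1 hb) h2
  · intro b hb
    simp only [Set.mem_iUnion]
    by_contra! hc
    refine hb (WfDvdMonoid.isRelPrime_of_no_irreducible_factors (fun h ↦ hQ h.1) ?_)
    intro z hz hzQ hzD
    obtain ⟨H, hH, hass⟩ := UniqueFactorizationMonoid.exists_mem_factors_of_dvd hQ hz hzQ
    exact hc H (by simpa using hH) (hass.symm.dvd.trans hzD)

variable [IsAlgClosed K]

/-- Some line `y = a + b x` meets the curve `Q = 0` in the expected number of points. -/
theorem exists_transversal_line {Q : K[X][Y]} {d : ℕ} (hdeg : TotalDegreeLE Q d)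
    (htop : ∃ j ≤ d, (Q.coeff j).coeff (d - j) ≠ 0)
    (hsing : ∀ H, Irreducible H → H ∣ Q → H ∣ derivX Q → ¬ H ∣ derivative Q) :
    ∃ a b : K, (restrictLine Q a b).coeff d ≠ 0 ∧ ∀ x, (restrictLine Q a b).eval x = 0 →
      (derivative (restrictLine Q a b)).eval x ≠ 0 := by
  obtain ⟨j, hj, hne⟩ := htop
  have hQ : Q ≠ 0 := by rintro rfl; simp at hne
  set t : K[X] := ∑ j ∈ Finset.range (d + 1), C ((Q.coeff j).coeff (d - j)) * X ^ j with ht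
  have ht0 : t ≠ 0 := by
    intro h0
    have := congrArg (fun p ↦ p.coeff j) h0
    simp only [ht, finsetSum_coeff, coeff_C_mul, coeff_X_pow] at this
    simp [hj, hne] at this
  obtain ⟨b, hb⟩ := ((finite_not_isRelPrime_polar hQ hsing).union
    (finite_eval_eq_zero ht0)).infinite_compl.nonempty
  simp only [Set.mem_compl_iff, Set.mem_union, Set.mem_ofPred_eq, not_or, not_not] at hb
  obtain ⟨a, ha⟩ := ((finite_common_zeros hb.1).image
    fun z ↦ z.2 - b * z.1).infinite_compl.nonempty
  refine ⟨a, b, by rw [coeff_restrictLine hdeg]; exact hb.2, fun x hx hx' ↦ ha ?_⟩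
  rw [derivative_restrictLine, eval_restrictLine] at hx'
  rw [eval_restrictLine] at hx
  exact ⟨(x, a + b * x), ⟨hx, hx'⟩, by simp⟩

/-- A generic line meets the part of the curve `Q = 0` that lies in the torus in as many points
as the total degree of `Q`, provided that `Q` has no multiple component and that no coordinate
axis is a component of it. -/
theorem curveHasDegree_of_totalDegree {Q : K[X][Y]} {d : ℕ} (hdeg : TotalDegreeLE Q d)
    (htop : ∃ j ≤ d, (Q.coeff j).coeff (d - j) ≠ 0)
    (hsing : ∀ H, Irreducible H → H ∣ Q → H ∣ derivX Q → ¬ H ∣ derivative Q)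
    (hX : ¬ C X ∣ Q) (hY : ¬ X ∣ Q) :
    CurveHasDegree {z : Torus K 2 | Q.evalEval (z 0 : K) (z 1 : K) = 0} d := by
  classical
  obtain ⟨a₀, b₀, htop₀, hsimple⟩ := exists_transversal_line hdeg htop hsing
  have hirrX : Irreducible (C X : K[X][Y]) := (prime_C_iff.2 prime_X).irreducible
  -- the points of the curve on the coordinate axes, which a generic line avoids
  have haxes : {z : K × K | (C X * X : K[X][Y]).evalEval z.1 z.2 = 0 ∧
      Q.evalEval z.1 z.2 = 0}.Finite :=
    finite_common_zeros (IsRelPrime.mul_left (hirrX.isRelPrime_iff_not_dvd.2 hX)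
      (prime_X.irreducible.isRelPrime_iff_not_dvd.2 hY))
  set G := restrictGenericLine Q d with hG
  have hGdeg : G.natDegree ≤ d := natDegree_restrictGenericLine_le hdeg
  set R := G.resultant (derivative G) d (d - 1) with hR
  have hGdeg' : (derivative G).natDegree ≤ d - 1 :=
    (natDegree_derivative_le _).trans (Nat.sub_le_sub_right hGdeg 1)
  have hev : ∀ l : Fin 3 → K, MvPolynomial.eval l R =
      (G.map (MvPolynomial.eval l)).resultant (derivative (G.map (MvPolynomial.eval l)))
        d (d - 1) := fun l ↦ by
    rw [hR, derivative_map, resultant_map_map]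
  have hGl : ∀ l : Fin 3 → K, (G.map (MvPolynomial.eval l)).natDegree ≤ d := fun l ↦
    natDegree_map_le.trans hGdeg
  have hGl' : ∀ l : Fin 3 → K, (derivative (G.map (MvPolynomial.eval l))).natDegree ≤ d - 1 :=
    fun l ↦ (natDegree_derivative_le _).trans (Nat.sub_le_sub_right (hGl l) 1)
  -- the transversal line shows that the discriminant and the leading coefficient do not vanish
  have hG₀ : G.map (MvPolynomial.eval ![-a₀, -b₀, 1]) = restrictLine Q a₀ b₀ := by
    rw [hG, map_restrictGenericLine hdeg (by simp)]; simp
  have hlead : G.coeff d ≠ 0 := fun h0 ↦ by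
    have := congrArg (fun p ↦ p.coeff d) hG₀
    rw [coeff_map, h0, map_zero] at this
    exact htop₀ this.symm
  have hR0 : R ≠ 0 := fun h0 ↦ by
    have h1 := hev ![-a₀, -b₀, 1]
    rw [h0, map_zero] at h1
    rcases exists_common_root_of_resultant_eq_zero (hGl _) (hGl' _) h1.symm with ⟨t, h2, h3⟩ | h2
    · rw [hG₀] at h2 h3
      exact hsimple t h2 h3
    · rw [hG₀] at h2
      exact htop₀ h2.1
  let A : MvPolynomial (Fin 3) K := ∏ z ∈ haxes.toFinset,
    (MvPolynomial.X 0 + MvPolynomial.X 1 * MvPolynomial.C z.1 +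
      MvPolynomial.X 2 * MvPolynomial.C z.2)
  have hA : A ≠ 0 := by
    refine Finset.prod_ne_zero_iff.2 fun z _ h0 ↦ ?_
    have := congrArg (MvPolynomial.eval ![1, 0, 0]) h0
    simp at this
  refine ⟨MvPolynomial.X 2 * G.coeff d * R * A,
    mul_ne_zero (mul_ne_zero (mul_ne_zero (MvPolynomial.X_ne_zero 2) hlead) hR0) hA,
    fun l hl ↦ ?_⟩
  simp only [map_mul, MvPolynomial.eval_X, mul_ne_zero_iff] at hl
  obtain ⟨⟨⟨hl2, hl3⟩, hl4⟩, hl5⟩ := hl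
  set q := G.map (MvPolynomial.eval l) with hq
  have hqe : ∀ x, q.eval x = l 2 ^ d * Q.evalEval x (-l 0 / l 2 + -l 1 / l 2 * x) := fun x ↦ by
    rw [hq, hG, map_restrictGenericLine hdeg hl2, eval_mul, eval_C, eval_restrictLine]
  have hqd : q.coeff d ≠ 0 := by rwa [hq, coeff_map]
  have hqdeg : q.natDegree = d := le_antisymm (hGl l) (le_natDegree_of_ne_zero hqd)
  have hcount : {x | q.eval x = 0}.encard = d := by
    rw [← hqdeg]
    refine encard_roots_of_simple (fun h0 ↦ hqd (by simp [h0])) fun x hx hx' ↦ ?_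
    by_cases hd : d = 0
    · rw [hd] at hqdeg hqd
      rw [eq_C_of_natDegree_eq_zero hqdeg, eval_C] at hx
      exact hqd hx
    · exact hl4 (by
        rw [hev]
        exact resultant_eq_zero_of_common_root (hGl l) (hGl' l) (Or.inl hd) hx hx')
  rw [← hcount]
  have hinj : Set.InjOn (fun z : Torus K 2 ↦ (z 0 : K))
      {z ∈ {z : Torus K 2 | Q.evalEval (z 0 : K) (z 1 : K) = 0} |
        l 0 + l 1 * (z 0 : K) + l 2 * (z 1 : K) = 0} := by
    rintro z ⟨-, hz⟩ w ⟨-, hw⟩ hzw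
    simp only at hzw
    have h1 : (z 1 : K) = w 1 := by
      rw [hzw] at hz
      exact mul_left_cancel₀ hl2 (by linear_combination hz - hw)
    ext i
    fin_cases i
    · exact hzw
    · exact h1
  rw [← hinj.encard_image]
  congr 1
  ext x
  constructor
  · rintro ⟨z, ⟨hz, hzl⟩, rfl⟩
    have h1 : (z 1 : K) = -l 0 / l 2 + -l 1 / l 2 * z 0 := by
      field_simp; linear_combination hzl
    simp only [Set.mem_ofPred_eq] at hz ⊢
    rw [hqe, ← h1, hz, mul_zero]
  · intro hx
    simp only [Set.mem_ofPred_eq] at hx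
    rw [hqe, mul_eq_zero] at hx
    have hx1 := hx.resolve_left (pow_ne_zero _ hl2)
    set y := -l 0 / l 2 + -l 1 / l 2 * x with hy
    have hline : l 0 + l 1 * x + l 2 * y = 0 := by rw [hy]; field_simp; ring
    have hxy : x * y ≠ 0 := fun h0 ↦ hl5 (by
      rw [map_prod]
      refine Finset.prod_eq_zero (i := (x, y)) ?_ (by simpa using hline)
      simpa [evalEval_mul, evalEval_C, hx1] using h0)
    exact ⟨![Units.mk0 x (left_ne_zero_of_mul hxy), Units.mk0 y (right_ne_zero_of_mul hxy)],
      ⟨by simpa using hx1, by simpa using hline⟩, by simp⟩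

end Lines

/-! ### The Zariski topology of the torus and power maps -/

section Zariski

variable {K : Type*} [Field K] {n : ℕ}

/-- The character `m ↦ zᵐ` of `ℤⁿ` attached to a point `z` of the torus. -/
def torusCharacter (z : Torus K n) : Multiplicative (Fin n → ℤ) →* K where
  toFun m := ((∏ i, z i ^ m.toAdd i : Kˣ) : K)
  map_one' := by simp
  map_mul' a b := by simp [zpow_add, Finset.prod_mul_distrib]

/-- Evaluation at a point of the torus, as an algebra homomorphism. -/
noncomputable def evalHom (z : Torus K n) : Laurent K n →ₐ[K] K :=
  AddMonoidAlgebra.lift K K (Fin n → ℤ) (torusCharacter z)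

theorem laurentEval_eq (F : Laurent K n) (z : Torus K n) : laurentEval F z = evalHom z F := by
  rw [evalHom, AddMonoidAlgebra.lift_apply]
  rfl

theorem evalHom_single (z : Torus K n) (m : Fin n → ℤ) (c : K) :
    evalHom z (AddMonoidAlgebra.single m c) = c * ((∏ i, z i ^ m i : Kˣ) : K) := by
  rw [evalHom, AddMonoidAlgebra.lift_single]
  rfl

theorem evalHom_single_single (z : Torus K n) (i : Fin n) (c : K) :
    evalHom z (AddMonoidAlgebra.single (Pi.single i 1) c) = c * z i := by
  rw [evalHom_single]
  congr 2
  rw [Finset.prod_eq_single i] <;> simp +contextual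

theorem mem_zariskiClosure {S : Set (Torus K n)} {z : Torus K n} :
    z ∈ zariskiClosure S ↔
      ∀ F : Laurent K n, (∀ w ∈ S, evalHom w F = 0) → evalHom z F = 0 := by
  simp only [zariskiClosure, zeroLocus, vanishing, Set.mem_ofPred_eq, laurentEval_eq]

theorem subset_zariskiClosure (S : Set (Torus K n)) : S ⊆ zariskiClosure S := fun z hz ↦
  mem_zariskiClosure.2 fun _ hF ↦ hF z hz

theorem zariskiClosure_mono {S T : Set (Torus K n)} (h : S ⊆ T) :
    zariskiClosure S ⊆ zariskiClosure T := fun _ hz ↦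
  mem_zariskiClosure.2 fun F hF ↦ mem_zariskiClosure.1 hz F fun w hw ↦ hF w (h hw)

theorem isZariskiClosed_zariskiClosure (S : Set (Torus K n)) :
    IsZariskiClosed (zariskiClosure S) := ⟨_, rfl⟩

theorem IsZariskiClosed.zariskiClosure_eq {Z : Set (Torus K n)} (h : IsZariskiClosed Z) :
    zariskiClosure Z = Z := by
  refine Set.Subset.antisymm (fun z hz ↦ ?_) (subset_zariskiClosure Z)
  obtain ⟨I, rfl⟩ := h
  intro F hF
  rw [laurentEval_eq]
  exact mem_zariskiClosure.1 hz F fun w hw ↦ by rw [← laurentEval_eq]; exact hw F hF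

theorem zariskiClosure_subset {S Z : Set (Torus K n)} (hZ : IsZariskiClosed Z) (h : S ⊆ Z) :
    zariskiClosure S ⊆ Z := by
  rw [← hZ.zariskiClosure_eq]
  exact zariskiClosure_mono h

theorem isZariskiClosed_of_finite {W : Set (Torus K n)} (hW : W.Finite) : IsZariskiClosed W := by
  suffices h : zariskiClosure W = W from h ▸ isZariskiClosed_zariskiClosure W
  refine Set.Subset.antisymm (fun z hz ↦ ?_) (subset_zariskiClosure W)
  by_contra hzW
  have hne : ∀ w : Torus K n, ∃ G : Laurent K n, evalHom w G = 0 ∧ (w ≠ z → evalHom z G ≠ 0) := by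
    intro w
    by_cases hwz : w = z
    · exact ⟨0, by simp, fun h ↦ absurd hwz h⟩
    · obtain ⟨i, hi⟩ := Function.ne_iff.1 hwz
      refine ⟨AddMonoidAlgebra.single (Pi.single i 1) 1 - algebraMap K _ (w i : K), ?_, fun _ ↦ ?_⟩
      · rw [map_sub, evalHom_single_single, AlgHom.commutes]; simp
      · rw [map_sub, evalHom_single_single, AlgHom.commutes, one_mul, sub_ne_zero]
        exact fun h ↦ hi (Units.ext h.symm)
  choose G hG hG' using hne
  have := mem_zariskiClosure.1 hz (∏ w ∈ hW.toFinset, G w) fun w hw ↦ by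
    rw [map_prod]
    exact Finset.prod_eq_zero (hW.mem_toFinset.2 hw) (hG w)
  rw [map_prod, Finset.prod_eq_zero_iff] at this
  obtain ⟨w, hw, h0⟩ := this
  have hw' := hW.mem_toFinset.1 hw
  exact hG' w (fun h ↦ hzW (h ▸ hw')) h0

/-- The endomorphism `z ↦ (z₁ ^ s₁, …, zₙ ^ sₙ)` of the torus. -/
def powMap (s : Fin n → ℤ) (z : Torus K n) : Torus K n := fun i ↦ z i ^ s i

theorem exists_eval_powMap (s : Fin n → ℤ) (F : Laurent K n) :
    ∃ G : Laurent K n, ∀ z, evalHom z G = evalHom (powMap s z) F := by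
  induction F using AddMonoidAlgebra.induction_linear with
  | zero => exact ⟨0, by simp⟩
  | add F₁ F₂ h₁ h₂ =>
    obtain ⟨G₁, hG₁⟩ := h₁
    obtain ⟨G₂, hG₂⟩ := h₂
    exact ⟨G₁ + G₂, fun z ↦ by simp [hG₁, hG₂]⟩
  | single m c =>
    refine ⟨AddMonoidAlgebra.single (fun i ↦ s i * m i) c, fun z ↦ ?_⟩
    simp [evalHom_single, powMap, zpow_mul]

theorem IsZariskiClosed.preimage_powMap {Z : Set (Torus K n)} (h : IsZariskiClosed Z)
    (s : Fin n → ℤ) : IsZariskiClosed (powMap s ⁻¹' Z) := by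
  obtain ⟨I, rfl⟩ := h
  choose G hG using exists_eval_powMap (K := K) s
  refine ⟨G '' I, ?_⟩
  ext z
  simp [zeroLocus, laurentEval_eq, hG]

/-- The group of all `ζ` with `ζᵢ ^ sᵢ = 1` for each `i`. -/
def powKer (K : Type*) [Field K] (s : Fin n → ℤ) : Subgroup (Torus K n) where
  carrier := {ζ | ∀ i, ζ i ^ s i = 1}
  one_mem' := by simp
  mul_mem' ha hb i := by simp [mul_zpow, ha i, hb i]
  inv_mem' ha i := by simp [ha i]

/-- The character `ζ ↦ ζᵐ` of the group `powKer K s`. -/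
def kerCharacter (s m : Fin n → ℤ) : powKer K s →* K where
  toFun ζ := ((∏ i, ζ.1 i ^ m i : Kˣ) : K)
  map_one' := by simp
  map_mul' a b := by simp [mul_zpow, Finset.prod_mul_distrib]

/-- If `F` vanishes on the preimage of `A` under `powMap s`, then so does each part of `F` that
consists of the monomials on which the kernel of `powMap s` acts by a given character. -/
theorem sum_isotypic_eq_zero {s : Fin n → ℤ} {A : Set (Torus K n)} {F : Laurent K n}
    (hF : ∀ z ∈ powMap s ⁻¹' A, evalHom z F = 0) [DecidableEq (powKer K s →* K)]
    (χ : powKer K s →* K) {z : Torus K n} (hz : z ∈ powMap s ⁻¹' A) :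
    ∑ m ∈ F.coeff.support with kerCharacter s m = χ,
      F.coeff m * ((∏ i, z i ^ m i : Kˣ) : K) = 0 := by
  set c : (powKer K s →* K) → K := fun χ ↦ ∑ m ∈ F.coeff.support with kerCharacter s m = χ,
    F.coeff m * ((∏ i, z i ^ m i : Kˣ) : K) with hc
  set T := F.coeff.support.image (kerCharacter (K := K) s) with hT
  have hlin := linearIndependent_iff'.1 (linearIndependent_monoidHom (powKer K s) K) T c (by
    ext ζ
    have h1 : evalHom (ζ.1 * z) F = 0 := hF _ (by
      have : powMap s (ζ.1 * z) = powMap s z := by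
        funext i
        simp [powMap, mul_zpow, ζ.2 i]
      rw [Set.mem_preimage, this]
      exact hz)
    rw [← laurentEval_eq, laurentEval, ← Finset.sum_fiberwise_of_maps_to
      (g := kerCharacter (K := K) s) (t := T) fun m hm ↦ Finset.mem_image_of_mem _ hm] at h1
    simp only [Finset.sum_apply, Pi.smul_apply, smul_eq_mul, Pi.zero_apply]
    rw [← h1]
    refine Finset.sum_congr rfl fun ψ _ ↦ ?_
    rw [hc, Finset.sum_mul]
    refine Finset.sum_congr rfl fun m hm ↦ ?_
    rw [← (Finset.mem_filter.1 hm).2]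
    simp only [kerCharacter, MonoidHom.coe_mk, OneHom.coe_mk, Pi.mul_apply, mul_zpow,
      Finset.prod_mul_distrib, Units.val_mul]
    ring)
  by_cases hχ : χ ∈ T
  · exact hlin χ hχ
  · refine Finset.sum_eq_zero fun m hm ↦ absurd ?_ hχ
    rw [Finset.mem_filter] at hm
    exact Finset.mem_image.2 ⟨m, hm⟩

variable [IsAlgClosed K]

theorem powMap_surjective {s : Fin n → ℤ} (hs : ∀ i, s i ≠ 0) :
    Function.Surjective (powMap (K := K) s) := by
  intro q
  have : ∀ i, ∃ x : Kˣ, x ^ s i = q i := by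
    intro i
    obtain ⟨x, hx⟩ := IsAlgClosed.exists_pow_nat_eq (q i : K) (Int.natAbs_pos.2 (hs i))
    have hx0 : x ≠ 0 := by
      rintro rfl
      rw [zero_pow (Int.natAbs_pos.2 (hs i)).ne'] at hx
      exact (q i).ne_zero hx.symm
    have hxu : Units.mk0 x hx0 ^ (s i).natAbs = q i := Units.ext (by simpa using hx)
    rcases Int.natAbs_eq (s i) with h | h
    · exact ⟨Units.mk0 x hx0, by rw [h, zpow_natCast]; exact hxu⟩
    · exact ⟨(Units.mk0 x hx0)⁻¹, by rw [h, inv_zpow', neg_neg, zpow_natCast]; exact hxu⟩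
  choose x hx using this
  exact ⟨x, funext hx⟩

theorem dvd_sub_of_kerCharacter_eq {s m m' : Fin n → ℤ} (hs : ∀ i, (s i : K) ≠ 0)
    (h : kerCharacter (K := K) s m = kerCharacter s m') (i : Fin n) : s i ∣ m i - m' i := by
  have : NeZero ((s i).natAbs : K) := ⟨by
    have := hs i
    rcases Int.natAbs_eq (s i) with h | h
    · rw [h] at this; simpa using this
    · rw [h] at this; simpa using this⟩
  obtain ⟨ζ, hζ⟩ := HasEnoughRootsOfUnity.exists_primitiveRoot K (s i).natAbs
  have hn : (s i).natAbs ≠ 0 := fun h0 ↦ NeZero.ne ((s i).natAbs : K) (by rw [h0, Nat.cast_zero])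
  have hu := hζ.isUnit hn
  have hζ' : IsPrimitiveRoot hu.unit (s i).natAbs := hζ.isUnit_unit hn
  have hmem : Function.update (1 : Torus K n) i hu.unit ∈ powKer K s := by
    intro j
    by_cases hj : j = i
    · subst hj
      simp only [Function.update_self]
      exact (hζ'.zpow_eq_one_iff_dvd _).2 (Int.natAbs_dvd.2 dvd_rfl)
    · simp [Function.update_of_ne hj]
  have h1 : ∏ j, (Function.update (1 : Torus K n) i hu.unit) j ^ m j =
      ∏ j, (Function.update (1 : Torus K n) i hu.unit) j ^ m' j :=
    Units.ext (by simpa only [kerCharacter, MonoidHom.coe_mk, OneHom.coe_mk] using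
      DFunLike.congr_fun h ⟨_, hmem⟩)
  have h2 : ∀ k : Fin n → ℤ, ∏ j, (Function.update (1 : Torus K n) i hu.unit) j ^ k j =
      hu.unit ^ k i := fun k ↦ by
    rw [Finset.prod_eq_single i] <;> simp +contextual [Function.update_of_ne]
  simp only [h2] at h1
  rw [← Int.natAbs_dvd, ← hζ'.zpow_eq_one_iff_dvd, zpow_sub, h1, mul_inv_cancel]

/-- When the exponents are prime to the characteristic, `powMap s` is an open map: taking
preimages commutes with Zariski closure. -/
theorem zariskiClosure_preimage_powMap {s : Fin n → ℤ} (hs : ∀ i, (s i : K) ≠ 0)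
    (A : Set (Torus K n)) :
    zariskiClosure (powMap s ⁻¹' A) = powMap s ⁻¹' zariskiClosure A := by
  classical
  refine Set.Subset.antisymm (zariskiClosure_subset
    ((isZariskiClosed_zariskiClosure A).preimage_powMap s)
    (Set.preimage_mono (subset_zariskiClosure A))) fun z hz ↦ mem_zariskiClosure.2 fun F hF ↦ ?_
  rw [← laurentEval_eq, laurentEval, ← Finset.sum_fiberwise_of_maps_to
    (g := kerCharacter (K := K) s) (t := F.coeff.support.image (kerCharacter (K := K) s))
    fun m hm ↦ Finset.mem_image_of_mem _ hm]
  refine Finset.sum_eq_zero fun χ hχ ↦ ?_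
  obtain ⟨m₀, -, hm₀⟩ := Finset.mem_image.1 hχ
  -- the isotypic part of `F` is `z ^ m₀` times a Laurent polynomial in the `zᵢ ^ sᵢ`
  have hk : ∀ m, ∃ k : Fin n → ℤ, kerCharacter (K := K) s m = χ → ∀ i, m i = m₀ i + s i * k i := by
    intro m
    by_cases h : kerCharacter (K := K) s m = χ
    · choose k hk using dvd_sub_of_kerCharacter_eq hs (h.trans hm₀.symm)
      exact ⟨k, fun _ i ↦ by rw [← hk]; ring⟩
    · exact ⟨0, fun h' ↦ absurd h' h⟩
  choose k hk using hk
  let G : Laurent K n := ∑ m ∈ F.coeff.support with kerCharacter s m = χ,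
    AddMonoidAlgebra.single (k m) (F.coeff m)
  have hG : ∀ w : Torus K n, ((∏ i, w i ^ m₀ i : Kˣ) : K) * evalHom (powMap s w) G =
      ∑ m ∈ F.coeff.support with kerCharacter s m = χ,
        F.coeff m * ((∏ i, w i ^ m i : Kˣ) : K) := by
    intro w
    rw [map_sum, Finset.mul_sum]
    refine Finset.sum_congr rfl fun m hm ↦ ?_
    have h1 : ∏ i, w i ^ m i = (∏ i, w i ^ m₀ i) * ∏ i, powMap s w i ^ k m i := by
      rw [← Finset.prod_mul_distrib]
      refine Finset.prod_congr rfl fun i _ ↦ ?_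
      rw [hk m (Finset.mem_filter.1 hm).2 i, zpow_add, zpow_mul, powMap]
    rw [evalHom_single, h1, Units.val_mul]
    ring
  rw [← hG]
  refine mul_eq_zero_of_right _ (mem_zariskiClosure.1 hz G fun q hq ↦ ?_)
  obtain ⟨w, rfl⟩ := powMap_surjective (K := K) (s := s) (fun i h0 ↦ hs i (by simp [h0])) q
  have := (hG w).trans (sum_isotypic_eq_zero hF χ hq)
  exact (mul_eq_zero.1 this).resolve_left (Units.ne_zero _)

end Zariski

/-! ### Derivatives and points of irreducible bivariate polynomials -/

section Bivariate

variable {K : Type*} [Field K]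

theorem coeff_derivX (P : K[X][Y]) (j : ℕ) : (derivX P).coeff j = derivative (P.coeff j) := by
  induction P using Polynomial.induction_on' with
  | add p q hp hq => simp [derivX_add, hp, hq]
  | monomial n r =>
    induction r using Polynomial.induction_on' with
    | add p q hp hq => simp only [map_add, derivX_add, coeff_add, hp, hq]
    | monomial i c =>
      rw [derivX_monomial, coeff_monomial, coeff_monomial]
      split_ifs
      · rw [derivative_monomial]
      · simp

theorem natCast_mul_coeff_eq_zero_of_derivX {P : K[X][Y]} (h : derivX P = 0) (i j : ℕ) :
    (i : K) * (P.coeff j).coeff i = 0 := by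
  rcases i with - | i
  · simp
  · have h1 := coeff_derivX P j
    rw [h, coeff_zero] at h1
    have := congrArg (fun p ↦ p.coeff i) h1
    simp only [coeff_zero, coeff_derivative] at this
    push_cast
    linear_combination -this

theorem natCast_mul_coeff_eq_zero_of_derivative {P : K[X][Y]} (h : derivative P = 0) (i j : ℕ) :
    (j : K) * (P.coeff j).coeff i = 0 := by
  rcases j with - | j
  · simp
  · have := congrArg (fun p ↦ (p.coeff j).coeff i) h
    simp only [coeff_zero, coeff_derivative] at this
    rw [← Nat.cast_succ, ← C_eq_natCast, coeff_mul_C] at this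
    rw [mul_comm]
    simpa using this

/-- Over a perfect field a polynomial with vanishing partial derivatives is constant or a `p`-th
power; in particular it is not irreducible. -/
theorem derivX_ne_zero_or_derivative_ne_zero [IsAlgClosed K] {P : K[X][Y]} (hP : Irreducible P) :
    derivX P ≠ 0 ∨ derivative P ≠ 0 := by
  by_contra! h
  have h1 := natCast_mul_coeff_eq_zero_of_derivX h.1
  have h2 := natCast_mul_coeff_eq_zero_of_derivative h.2
  obtain ⟨p, hp⟩ := ExpChar.exists K
  cases hp with
  | zero =>
    have hPC : P = C (C ((P.coeff 0).coeff 0)) := by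
      ext j i
      rw [coeff_C]
      split_ifs with hj
      · subst hj
        rw [coeff_C]
        split_ifs with hi
        · rw [hi]
        · exact (mul_eq_zero.1 (h1 i 0)).resolve_left (Nat.cast_ne_zero.2 hi)
      · rw [coeff_zero]
        exact (mul_eq_zero.1 (h2 i j)).resolve_left (Nat.cast_ne_zero.2 hj)
    refine hP.not_isUnit ?_
    rw [hPC]
    refine ((isUnit_iff_ne_zero.2 fun h0 ↦ hP.ne_zero ?_).map C).map C
    rw [hPC, h0, C_0, C_0]
  | prime hp =>
    have : Fact p.Prime := ⟨hp⟩
    have hmem : P ∈ (frobenius K[X][Y] p).range := by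
      rw [← sum_monomial_eq P, Polynomial.sum]
      refine Subring.sum_mem _ fun j _ ↦ ?_
      rw [← sum_monomial_eq (P.coeff j), Polynomial.sum, map_sum]
      refine Subring.sum_mem _ fun i _ ↦ ?_
      by_cases hc : (P.coeff j).coeff i = 0
      · rw [hc]; simp
      · obtain ⟨i', rfl⟩ := (CharP.cast_eq_zero_iff K p i).1
          ((mul_eq_zero.1 (h1 i j)).resolve_right hc)
        obtain ⟨j', rfl⟩ := (CharP.cast_eq_zero_iff K p j).1
          ((mul_eq_zero.1 (h2 _ j)).resolve_right hc)
        obtain ⟨b, hb⟩ := IsAlgClosed.exists_pow_nat_eq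
          ((P.coeff (p * j')).coeff (p * i')) hp.pos
        refine ⟨monomial j' (monomial i' b), ?_⟩
        rw [frobenius_def, monomial_pow, monomial_pow, hb, mul_comm j', mul_comm i']
    obtain ⟨R, hR⟩ := hmem
    rw [frobenius_def] at hR
    exact not_irreducible_pow hp.one_lt.ne' (hR ▸ hP)

theorem infinite_units (K : Type*) [Field K] [Infinite K] : Infinite Kˣ :=
  (unitsEquivNeZero (G₀ := K)).infinite_iff.2
    (Set.infinite_coe_iff.2 (Set.finite_singleton (0 : K)).infinite_compl)

/-- An irreducible plane curve that is not a coordinate axis has infinitely many points in the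
torus. -/
theorem infinite_torus_zeros [IsAlgClosed K] {H : K[X][Y]} (hH : Irreducible H)
    (hX : ¬ C X ∣ H) (hY : ¬ X ∣ H) :
    {z : Torus K 2 | H.evalEval (z 0 : K) (z 1 : K) = 0}.Infinite := by
  by_cases hd : H.natDegree = 0
  · obtain ⟨h, rfl⟩ := natDegree_eq_zero.1 hd
    have hdeg : h.degree ≠ 0 := fun h0 ↦ hH.not_isUnit ((isUnit_iff_degree_eq_zero.2 h0).map C)
    obtain ⟨x, hx⟩ := IsAlgClosed.exists_root h hdeg
    have hx0 : x ≠ 0 := by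
      rintro rfl
      obtain ⟨r, hr⟩ := X_dvd_iff.2 ((coeff_zero_eq_eval_zero h).trans hx)
      exact hX ⟨C r, by rw [hr, C_mul]⟩
    have := infinite_units K
    refine Set.infinite_of_injective_forall_mem (f := fun y : Kˣ ↦ ![Units.mk0 x hx0, y])
      (fun y y' h ↦ by simpa using congrFun h 1) fun y ↦ ?_
    simpa [evalEval_C] using hx
  · have hlead : H.leadingCoeff ≠ 0 := by simpa using hH.ne_zero
    have h0 : H.coeff 0 ≠ 0 := fun h ↦ hY (X_dvd_iff.2 h)
    have hinf := ((finite_eval_eq_zero (mul_ne_zero (mul_ne_zero hlead h0)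
      (X_ne_zero (R := K))))).infinite_compl
    refine Set.Infinite.of_image (fun z : Torus K 2 ↦ (z 0 : K)) (hinf.mono fun x hx ↦ ?_)
    simp only [Set.mem_compl_iff, Set.mem_ofPred_eq, eval_mul, eval_X, mul_eq_zero, not_or] at hx
    have hdeg : (H.map (evalRingHom x)).natDegree = H.natDegree :=
      natDegree_map_of_leadingCoeff_ne_zero _ hx.1.1
    obtain ⟨y, hy⟩ := IsAlgClosed.exists_root (H.map (evalRingHom x)) fun h ↦ hd (by
      rw [← hdeg, natDegree_eq_zero_iff_degree_le_zero, h])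
    have hy0 : y ≠ 0 := by
      rintro rfl
      rw [IsRoot, ← coeff_zero_eq_eval_zero, coeff_map] at hy
      exact hx.1.2 hy
    refine ⟨![Units.mk0 x hx.2, Units.mk0 y hy0], ?_, by simp⟩
    simpa [evalEval_eq_eval_map] using hy

end Bivariate

/-! ### Polynomials as Laurent polynomials -/

section Laurent

variable {K : Type*} [Field K]

/-- Polynomials in two variables as Laurent polynomials. -/
noncomputable def ofBivariate : K[X][Y] →ₐ[K] Laurent K 2 :=
  aevalAeval (AddMonoidAlgebra.single (Pi.single 0 1) 1) (AddMonoidAlgebra.single (Pi.single 1 1) 1)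

theorem ofBivariate_monomial (i j : ℕ) (c : K) :
    ofBivariate (monomial j (monomial i c)) = AddMonoidAlgebra.single ![(i : ℤ), (j : ℤ)] c := by
  have h : monomial j (monomial i c) = C (C c) * C X ^ i * (X : K[X][Y]) ^ j := by
    rw [← C_mul_X_pow_eq_monomial, ← C_mul_X_pow_eq_monomial, C_mul, C_pow]
  have h1 : ofBivariate (C (C c)) = AddMonoidAlgebra.single (0 : Fin 2 → ℤ) c := by
    rw [ofBivariate, aevalAeval_C, aeval_C]
    rfl
  have h2 : (Pi.single 0 (i : ℤ) + Pi.single 1 (j : ℤ) : Fin 2 → ℤ) = ![(i : ℤ), (j : ℤ)] := by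
    ext k; fin_cases k <;> simp
  rw [h, map_mul, map_mul, map_pow, map_pow, h1, ofBivariate, aevalAeval_X, aevalAeval_Y,
    AddMonoidAlgebra.single_pow, AddMonoidAlgebra.single_pow, AddMonoidAlgebra.single_mul_single,
    AddMonoidAlgebra.single_mul_single, one_pow, one_pow, mul_one, mul_one, zero_add, ← h2]
  congr 1
  ext k; fin_cases k <;> simp

theorem evalHom_ofBivariate (z : Torus K 2) (P : K[X][Y]) :
    evalHom z (ofBivariate P) = P.evalEval (z 0 : K) (z 1 : K) := by
  induction P using Polynomial.induction_on' with
  | add p q hp hq => simp [hp, hq, evalEval_add]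
  | monomial n r =>
    induction r using Polynomial.induction_on' with
    | add p q hp hq => simp only [map_add, evalEval_add, hp, hq]
    | monomial i c =>
      rw [ofBivariate_monomial, evalHom_single]
      simp [evalEval, eval_monomial, mul_assoc]

theorem ofBivariate_injective [Infinite K] : Function.Injective (ofBivariate (K := K)) := by
  refine (injective_iff_map_eq_zero _).2 fun P hP ↦ ?_
  have hinf : {x : K | x ≠ 0}.Infinite := (Set.finite_singleton 0).infinite_compl
  refine eq_zero_of_evalEval_eq_zero hinf hinf fun x hx y hy ↦ ?_
  have := evalHom_ofBivariate ![Units.mk0 x hx, Units.mk0 y hy] P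
  simpa [hP] using this.symm

end Laurent

/-! ### From Laurent polynomials to polynomials -/

section ShiftPoly

variable {K : Type*} [Field K]

/-- The polynomial `x^(-μ₀) y^(-μ₁) E(x^s₀, y^s₁)`. It is meaningful only if `μᵢ ≤ sᵢ mᵢ` for all
exponents `m` of `E`, since otherwise negative exponents are truncated to zero. -/
noncomputable def shiftPoly (E : Laurent K 2) (s μ : Fin 2 → ℤ) : K[X][Y] :=
  ∑ m ∈ E.coeff.support,
    monomial (s 1 * m 1 - μ 1).toNat (monomial (s 0 * m 0 - μ 0).toNat (E.coeff m))

/-- `μ` consists of the smallest exponents of the two variables in `E(x^s₀, y^s₁)`. -/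
def IsMinExponent (E : Laurent K 2) (s μ : Fin 2 → ℤ) : Prop :=
  (∀ m ∈ E.coeff.support, ∀ i, μ i ≤ s i * m i) ∧
    ∀ i, ∃ m ∈ E.coeff.support, μ i = s i * m i

theorem exists_isMinExponent {E : Laurent K 2} (hE : E ≠ 0) (s : Fin 2 → ℤ) :
    ∃ μ, IsMinExponent E s μ := by
  have hne : E.coeff.support.Nonempty := by
    rw [Finsupp.support_nonempty_iff]
    exact fun h ↦ hE (by rw [← E.ofCoeff_coeff, h]; rfl)
  have : ∀ i : Fin 2, ∃ m ∈ E.coeff.support, ∀ m' ∈ E.coeff.support, s i * m i ≤ s i * m' i :=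
    fun i ↦ Finset.exists_min_image _ (fun m ↦ s i * m i) hne
  choose m hm hmin using this
  exact ⟨fun i ↦ s i * m i i, fun m' hm' i ↦ hmin i m' hm', fun i ↦ ⟨m i, hm i, rfl⟩⟩

/-- The Euler operator `xᵢ ∂/∂xᵢ`. -/
noncomputable def euler (i : Fin 2) (F : Laurent K 2) : Laurent K 2 :=
  ∑ m ∈ F.coeff.support, AddMonoidAlgebra.single m (m i * F.coeff m)

theorem evalHom_eq_sum (z : Torus K 2) (F : Laurent K 2) : evalHom z F =
    ∑ m ∈ F.coeff.support, F.coeff m * ((z 0 ^ m 0 * z 1 ^ m 1 : Kˣ) : K) := by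
  rw [← laurentEval_eq, laurentEval]
  simp only [Fin.prod_univ_two]

theorem evalHom_euler (z : Torus K 2) (i : Fin 2) (F : Laurent K 2) : evalHom z (euler i F) =
    ∑ m ∈ F.coeff.support, m i * F.coeff m * ((z 0 ^ m 0 * z 1 ^ m 1 : Kˣ) : K) := by
  simp only [euler, map_sum, evalHom_single, Fin.prod_univ_two]

variable {E : Laurent K 2} {s μ : Fin 2 → ℤ}

theorem evalEval_monomial_monomial (x y : K) (i j : ℕ) (c : K) :
    (monomial j (monomial i c) : K[X][Y]).evalEval x y = c * x ^ i * y ^ j := by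
  simp [evalEval, eval_monomial]

theorem pow_shift (hμ : ∀ m ∈ E.coeff.support, ∀ i, μ i ≤ s i * m i) {m : Fin 2 → ℤ}
    (hm : m ∈ E.coeff.support) (z : Torus K 2) (i : Fin 2) :
    (z i : K) ^ (s i * m i - μ i).toNat =
      ((z i ^ (-μ i) : Kˣ) : K) * ((powMap s z i ^ m i : Kˣ) : K) := by
  rw [← Units.val_pow_eq_pow_val, ← Units.val_mul, ← zpow_natCast,
    Int.toNat_of_nonneg (sub_nonneg.2 (hμ m hm i)), powMap, ← zpow_mul, ← zpow_add]
  congr 2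
  ring

theorem evalEval_shiftPoly (hμ : ∀ m ∈ E.coeff.support, ∀ i, μ i ≤ s i * m i) (z : Torus K 2) :
    (shiftPoly E s μ).evalEval (z 0 : K) (z 1 : K) =
      ((z 0 ^ (-μ 0) * z 1 ^ (-μ 1) : Kˣ) : K) * evalHom (powMap s z) E := by
  rw [shiftPoly, evalEval_finsetSum, evalHom_eq_sum, Finset.mul_sum]
  refine Finset.sum_congr rfl fun m hm ↦ ?_
  rw [evalEval_monomial_monomial, pow_shift hμ hm, pow_shift hμ hm]
  push_cast
  ring

theorem derivX_sum {ι : Type*} (S : Finset ι) (f : ι → K[X][Y]) :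
    derivX (∑ i ∈ S, f i) = ∑ i ∈ S, derivX (f i) := by
  simp [derivX]

theorem natCast_mul_pow_pred (x : K) (n : ℕ) : x * (n * x ^ (n - 1)) = n * x ^ n := by
  rcases n with - | n
  · simp
  · rw [Nat.add_sub_cancel, pow_succ]; ring

theorem natCast_shift (hμ : ∀ m ∈ E.coeff.support, ∀ i, μ i ≤ s i * m i) {m : Fin 2 → ℤ}
    (hm : m ∈ E.coeff.support) (i : Fin 2) :
    ((s i * m i - μ i).toNat : K) = s i * m i - μ i := by
  rw [← Int.cast_natCast, Int.toNat_of_nonneg (sub_nonneg.2 (hμ m hm i))]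
  push_cast; rfl

theorem evalEval_derivX_shiftPoly (hμ : ∀ m ∈ E.coeff.support, ∀ i, μ i ≤ s i * m i)
    (z : Torus K 2) :
    (z 0 : K) * (derivX (shiftPoly E s μ)).evalEval (z 0 : K) (z 1 : K) =
      ((z 0 ^ (-μ 0) * z 1 ^ (-μ 1) : Kˣ) : K) *
        (s 0 * evalHom (powMap s z) (euler 0 E) - μ 0 * evalHom (powMap s z) E) := by
  rw [shiftPoly, derivX_sum, evalEval_finsetSum, evalHom_euler, evalHom_eq_sum, Finset.mul_sum,
    Finset.mul_sum, Finset.mul_sum, ← Finset.sum_sub_distrib, Finset.mul_sum]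
  refine Finset.sum_congr rfl fun m hm ↦ ?_
  rw [derivX_monomial, evalEval_monomial_monomial]
  have h := natCast_mul_pow_pred (z 0 : K) (s 0 * m 0 - μ 0).toNat
  rw [pow_shift hμ hm, natCast_shift hμ hm] at h
  rw [pow_shift hμ hm, natCast_shift hμ hm]
  push_cast at h ⊢
  linear_combination (E.coeff m * ((z 1 : K) ^ (-μ 1) * (powMap s z 1 : K) ^ m 1)) * h

theorem evalEval_derivative_shiftPoly (hμ : ∀ m ∈ E.coeff.support, ∀ i, μ i ≤ s i * m i)
    (z : Torus K 2) :
    (z 1 : K) * (derivative (shiftPoly E s μ)).evalEval (z 0 : K) (z 1 : K) =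
      ((z 0 ^ (-μ 0) * z 1 ^ (-μ 1) : Kˣ) : K) *
        (s 1 * evalHom (powMap s z) (euler 1 E) - μ 1 * evalHom (powMap s z) E) := by
  rw [shiftPoly, derivative_sum, evalEval_finsetSum, evalHom_euler, evalHom_eq_sum,
    Finset.mul_sum, Finset.mul_sum, Finset.mul_sum, ← Finset.sum_sub_distrib, Finset.mul_sum]
  refine Finset.sum_congr rfl fun m hm ↦ ?_
  have h0 : ∀ n : ℕ, (monomial (s 0 * m 0 - μ 0).toNat (E.coeff m) : K[X]) * (n : K[X]) =
      monomial (s 0 * m 0 - μ 0).toNat (E.coeff m * n) := fun n ↦ by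
    rw [← C_eq_natCast, monomial_mul_C]
  rw [derivative_monomial, h0, evalEval_monomial_monomial]
  have h := natCast_mul_pow_pred (z 1 : K) (s 1 * m 1 - μ 1).toNat
  rw [pow_shift hμ hm, natCast_shift hμ hm] at h
  rw [pow_shift hμ hm, natCast_shift hμ hm]
  push_cast at h ⊢
  linear_combination (E.coeff m * ((z 0 : K) ^ (-μ 0) * (powMap s z 0 : K) ^ m 0)) * h

theorem exists_of_coeff_shiftPoly_ne_zero {i j : ℕ}
    (h : ((shiftPoly E s μ).coeff j).coeff i ≠ 0) :
    ∃ m ∈ E.coeff.support, i = (s 0 * m 0 - μ 0).toNat ∧ j = (s 1 * m 1 - μ 1).toNat := by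
  rw [shiftPoly, finsetSum_coeff, finsetSum_coeff] at h
  obtain ⟨m, hm, hne⟩ := Finset.exists_ne_zero_of_sum_ne_zero h
  refine ⟨m, hm, ?_⟩
  rw [coeff_monomial] at hne
  split_ifs at hne with hj
  · rw [coeff_monomial] at hne
    split_ifs at hne with hi
    · exact ⟨hi.symm, hj.symm⟩
    · exact absurd rfl hne
  · simp at hne

theorem coeff_shiftPoly (hs : ∀ i, s i ≠ 0) (hμ : ∀ m ∈ E.coeff.support, ∀ i, μ i ≤ s i * m i)
    {m : Fin 2 → ℤ} (hm : m ∈ E.coeff.support) :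
    ((shiftPoly E s μ).coeff (s 1 * m 1 - μ 1).toNat).coeff (s 0 * m 0 - μ 0).toNat =
      E.coeff m := by
  rw [shiftPoly, finsetSum_coeff, finsetSum_coeff, Finset.sum_eq_single m]
  · rw [coeff_monomial, if_pos rfl, coeff_monomial, if_pos rfl]
  · intro m' hm' hne
    rw [coeff_monomial]
    split_ifs with h1
    · rw [coeff_monomial, if_neg]
      intro h0
      have key : ∀ i, (s i * m' i - μ i).toNat = (s i * m i - μ i).toNat → m' i = m i := by
        intro i hi
        have h2 := hμ m hm i
        have h3 := hμ m' hm' i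
        exact mul_left_cancel₀ (hs i) (by omega)
      refine hne (funext fun i ↦ ?_)
      fin_cases i
      · exact key 0 h0
      · exact key 1 h1
    · simp
  · exact fun h ↦ absurd hm h

theorem not_X_dvd_shiftPoly (hs : ∀ i, s i ≠ 0) (hμ : IsMinExponent E s μ) :
    ¬ C X ∣ shiftPoly E s μ := by
  intro h
  obtain ⟨m, hm, h0⟩ := hμ.2 0
  have h1 := coeff_shiftPoly hs hμ.1 hm
  rw [C_dvd_iff_dvd_coeff] at h
  have h2 := X_dvd_iff.1 (h (s 1 * m 1 - μ 1).toNat)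
  rw [h0, sub_self, Int.toNat_zero, h2] at h1
  exact (Finsupp.mem_support_iff.1 hm) h1.symm

theorem not_Y_dvd_shiftPoly (hs : ∀ i, s i ≠ 0) (hμ : IsMinExponent E s μ) :
    ¬ X ∣ shiftPoly E s μ := by
  intro h
  obtain ⟨m, hm, h0⟩ := hμ.2 1
  have h1 := coeff_shiftPoly hs hμ.1 hm
  rw [h0, sub_self, Int.toNat_zero, X_dvd_iff.1 h, coeff_zero] at h1
  exact (Finsupp.mem_support_iff.1 hm) h1.symm

theorem ofBivariate_shiftPoly (hμ : ∀ m ∈ E.coeff.support, ∀ i, μ i ≤ m i) :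
    ofBivariate (shiftPoly E 1 μ) = AddMonoidAlgebra.single (-μ) 1 * E := by
  conv_rhs => rw [← AddMonoidAlgebra.sum_coeff_single E, Finsupp.sum, Finset.mul_sum]
  rw [shiftPoly, map_sum]
  refine Finset.sum_congr rfl fun m hm ↦ ?_
  rw [ofBivariate_monomial, AddMonoidAlgebra.single_mul_single, one_mul]
  congr 1
  ext i
  have := hμ m hm i
  fin_cases i <;> simp at this ⊢ <;> omega

end ShiftPoly

/-! ### Irreducible Laurent polynomials -/

section Irreducible

variable {K : Type*} [Field K]

theorem isUnit_single (m : Fin 2 → ℤ) :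
    IsUnit (AddMonoidAlgebra.single m 1 : Laurent K 2) :=
  IsUnit.of_mul_eq_one (AddMonoidAlgebra.single (-m) 1) (by
    rw [AddMonoidAlgebra.single_mul_single, add_neg_cancel, mul_one]; rfl)

theorem exists_ofBivariate_eq (F : Laurent K 2) :
    ∃ (a b : ℕ) (P : K[X][Y]), ofBivariate P = ofBivariate (C X ^ a * X ^ b) * F := by
  have hX : ∀ a b : ℕ, ofBivariate (C X ^ a * X ^ b : K[X][Y]) =
      AddMonoidAlgebra.single ![(a : ℤ), (b : ℤ)] 1 := fun a b ↦ by
    rw [← ofBivariate_monomial]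
    congr 1
    rw [← C_mul_X_pow_eq_monomial, ← C_mul_X_pow_eq_monomial, C_1, one_mul, C_pow]
  by_cases hF : F = 0
  · exact ⟨0, 0, 0, by simp [hF]⟩
  obtain ⟨μ, hμ⟩ := exists_isMinExponent hF 1
  refine ⟨(μ 0).natAbs, (μ 1).natAbs, shiftPoly F 1 (fun i ↦ -(μ i).natAbs), ?_⟩
  rw [ofBivariate_shiftPoly, hX]
  · congr 2
    ext i; fin_cases i <;> simp
  · intro m hm i
    have := hμ.1 m hm i
    simp only [Pi.one_apply, one_mul] at this
    omega

/-- A bivariate polynomial that is invertible as a Laurent polynomial divides a monomial. -/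
theorem dvd_monomial_of_isUnit [Infinite K] {P : K[X][Y]} (h : IsUnit (ofBivariate P)) :
    ∃ a b : ℕ, P ∣ C X ^ a * X ^ b := by
  obtain ⟨W, hW⟩ := h.exists_right_inv
  obtain ⟨a, b, Q, hQ⟩ := exists_ofBivariate_eq W
  refine ⟨a, b, Q, ofBivariate_injective ?_⟩
  rw [map_mul ofBivariate P Q, hQ, mul_left_comm, hW, mul_one]

theorem isUnit_of_dvd_monomial {P : K[X][Y]} {a b : ℕ} (h : P ∣ C X ^ a * X ^ b)
    (hX : ¬ C X ∣ P) (hY : ¬ X ∣ P) : IsUnit P := by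
  have hpX : Prime (C X : K[X][Y]) := prime_C_iff.2 prime_X
  have h1 : IsRelPrime P (C X ^ a * X ^ b) :=
    IsRelPrime.mul_right (hpX.irreducible.isRelPrime_iff_not_dvd.2 hX).symm.pow_right
      (prime_X.irreducible.isRelPrime_iff_not_dvd.2 hY).symm.pow_right
  exact h1 dvd_rfl h

/-- An irreducible Laurent polynomial becomes an irreducible polynomial after division by the
largest monomial that divides it. -/
theorem irreducible_shiftPoly [Infinite K] {E : Laurent K 2} {μ : Fin 2 → ℤ}
    (hE : Irreducible E) (hμ : IsMinExponent E 1 μ) : Irreducible (shiftPoly E 1 μ) := by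
  have hX := not_X_dvd_shiftPoly (s := 1) (by simp) hμ
  have hY := not_Y_dvd_shiftPoly (s := 1) (by simp) hμ
  have hof := ofBivariate_shiftPoly (E := E) (μ := μ) (by simpa using hμ.1)
  have hirr : Irreducible (ofBivariate (shiftPoly E 1 μ)) := by
    rw [hof]
    exact (irreducible_isUnit_mul (isUnit_single _)).2 hE
  refine ⟨fun hu ↦ hirr.not_isUnit (hu.map ofBivariate), fun A B hAB ↦ ?_⟩
  have key : ∀ {A : K[X][Y]}, A ∣ shiftPoly E 1 μ → IsUnit (ofBivariate A) → IsUnit A := by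
    intro A hA hu
    obtain ⟨a, b, hab⟩ := dvd_monomial_of_isUnit hu
    exact isUnit_of_dvd_monomial hab (fun h ↦ hX (h.trans hA)) fun h ↦ hY (h.trans hA)
  exact (hirr.isUnit_or_isUnit (by rw [hAB, map_mul])).imp
    (key (hAB ▸ dvd_mul_right _ _)) (key (hAB ▸ dvd_mul_left _ _))

/-- An irreducible polynomial with a zero in the torus stays irreducible as a Laurent
polynomial. -/
theorem irreducible_ofBivariate [Infinite K] {P : K[X][Y]} (hP : Irreducible P) {z : Torus K 2}
    (hz : P.evalEval (z 0 : K) (z 1 : K) = 0) : Irreducible (ofBivariate P) := by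
  refine ⟨fun hu ↦ ?_, fun U V hUV ↦ ?_⟩
  · have := hu.map (evalHom z)
    rw [evalHom_ofBivariate, hz] at this
    exact not_isUnit_zero this
  obtain ⟨a, b, U', hU⟩ := exists_ofBivariate_eq U
  obtain ⟨c, d, V', hV⟩ := exists_ofBivariate_eq V
  have hmono : ∀ a b : ℕ, IsUnit (ofBivariate (C X ^ a * X ^ b : K[X][Y])) := fun a b ↦ by
    have : (C X ^ a * X ^ b : K[X][Y]) = monomial b (monomial a 1) := by
      rw [← C_mul_X_pow_eq_monomial, ← C_mul_X_pow_eq_monomial, C_1, one_mul, C_pow]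
    rw [this, ofBivariate_monomial]
    exact isUnit_single _
  have h : (C X ^ a * X ^ b) * (C X ^ c * X ^ d) * P = U' * V' := by
    refine ofBivariate_injective ?_
    simp only [map_mul _ _ P, map_mul _ U' V', hU, hV, hUV]
    rw [map_mul]
    ring
  have key : ∀ {A B : K[X][Y]} {W : Laurent K 2} {a b : ℕ} {M : K[X][Y]}, M ≠ 0 →
      IsUnit (ofBivariate M) → M * P = A * B → P ∣ A →
      ofBivariate B = ofBivariate (C X ^ a * X ^ b) * W → IsUnit W := by
    rintro A B W a b M hM hMu hMP ⟨A', rfl⟩ hB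
    have h1 : M = A' * B := by
      refine mul_right_cancel₀ hP.ne_zero ?_
      rw [hMP]; ring
    have h2 : IsUnit (ofBivariate B) := by
      rw [h1, map_mul] at hMu
      exact isUnit_of_mul_isUnit_right hMu
    rw [hB] at h2
    exact isUnit_of_mul_isUnit_right h2
  have hM0 : (C X ^ a * X ^ b) * (C X ^ c * X ^ d) ≠ (0 : K[X][Y]) := by
    have : (C X : K[X][Y]) ≠ 0 := C_ne_zero.2 X_ne_zero
    simp [this, X_ne_zero]
  have hMu : IsUnit (ofBivariate ((C X ^ a * X ^ b) * (C X ^ c * X ^ d) : K[X][Y])) := by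
    rw [map_mul]
    exact (hmono a b).mul (hmono c d)
  rcases hP.prime.dvd_or_dvd (h ▸ dvd_mul_left P _) with h1 | h1
  · exact Or.inr (key hM0 hMu h h1 hV)
  · exact Or.inl (key hM0 hMu (h.trans (mul_comm _ _)) h1 hU)

end Irreducible

/-! ### Singular points -/

section Singular

variable {K : Type*} [Field K]

theorem finite_torus_zeros {P Q : K[X][Y]} (h : IsRelPrime P Q) :
    {z : Torus K 2 | P.evalEval (z 0 : K) (z 1 : K) = 0 ∧
      Q.evalEval (z 0 : K) (z 1 : K) = 0}.Finite := by
  refine Set.Finite.of_finite_image (f := fun z : Torus K 2 ↦ ((z 0 : K), (z 1 : K)))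
    ((finite_common_zeros h).subset ?_) ?_
  · rintro _ ⟨z, hz, rfl⟩
    exact hz
  · rintro z - w - hzw
    simp only [Prod.mk.injEq] at hzw
    ext i
    fin_cases i
    · exact hzw.1
    · exact hzw.2

theorem finite_zpow_eq {s : ℤ} (hs : s ≠ 0) (q : Kˣ) : {x : Kˣ | x ^ s = q}.Finite := by
  have hn : 0 < s.natAbs := Int.natAbs_pos.2 hs
  have key : ∀ q : Kˣ, {x : Kˣ | x ^ s.natAbs = q}.Finite := fun q ↦ by
    refine ((finite_eval_eq_zero (X_pow_sub_C_ne_zero hn (q : K))).preimage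
      Units.val_injective.injOn).subset fun x hx ↦ ?_
    have : x ^ s.natAbs = q := hx
    simp [← this]
  rcases Int.natAbs_eq s with h | h
  · rw [h]
    simpa only [zpow_natCast] using key q
  · rw [h]
    refine (key q⁻¹).subset fun x hx ↦ ?_
    have : x ^ (-(s.natAbs : ℤ)) = q := hx
    rw [Set.mem_ofPred_eq, ← this, zpow_neg, inv_inv, zpow_natCast]

theorem finite_preimage_powMap {n : ℕ} {s : Fin n → ℤ} (hs : ∀ i, s i ≠ 0) {W : Set (Torus K n)}
    (hW : W.Finite) : (powMap s ⁻¹' W).Finite := by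
  refine hW.preimage' fun q _ ↦ ?_
  refine (Set.Finite.pi' fun i ↦ finite_zpow_eq (hs i) (q i)).subset fun z hz i ↦ ?_
  exact congrFun hz i

theorem powMap_one (z : Torus K 2) : powMap 1 z = z := by
  funext i; simp [powMap]

/-- An irreducible curve in the torus has only finitely many singular points. -/
theorem finite_singular [IsAlgClosed K] {E : Laurent K 2} (hE : Irreducible E) :
    {z : Torus K 2 | evalHom z E = 0 ∧ ∀ i, evalHom z (euler i E) = 0}.Finite := by
  obtain ⟨μ, hμ⟩ := exists_isMinExponent hE.ne_zero 1
  have hP := irreducible_shiftPoly hE hμ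
  set P := shiftPoly E 1 μ with hPdef
  have h0 : ∀ z : Torus K 2, evalHom z E = 0 → P.evalEval (z 0 : K) (z 1 : K) = 0 := fun z hz ↦ by
    rw [hPdef, evalEval_shiftPoly hμ.1, powMap_one, hz, mul_zero]
  rcases derivX_ne_zero_or_derivative_ne_zero hP with hne | hne
  · refine (finite_torus_zeros (hP.isRelPrime_iff_not_dvd.2
      fun h ↦ hne (derivX_eq_zero_of_dvd h))).subset fun z hz ↦ ⟨h0 z hz.1, ?_⟩
    have := evalEval_derivX_shiftPoly hμ.1 z
    rw [powMap_one, hz.1, hz.2 0, mul_zero, mul_zero, sub_zero, mul_zero, mul_eq_zero] at this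
    exact this.resolve_left (z 0).ne_zero
  · refine (finite_torus_zeros (hP.isRelPrime_iff_not_dvd.2
      fun h ↦ hne (derivative_eq_zero_of_dvd h))).subset fun z hz ↦ ⟨h0 z hz.1, ?_⟩
    have := evalEval_derivative_shiftPoly hμ.1 z
    rw [powMap_one, hz.1, hz.2 1, mul_zero, mul_zero, sub_zero, mul_zero, mul_eq_zero] at this
    exact this.resolve_left (z 1).ne_zero

/-- The pull-back of an irreducible curve under `powMap s` has no multiple component, because its
singular points lie above singular points. -/
theorem no_singular_component [IsAlgClosed K] {E : Laurent K 2} (hE : Irreducible E)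
    {s μ : Fin 2 → ℤ} (hs : ∀ i, (s i : K) ≠ 0) (hμ : IsMinExponent E s μ) (H : K[X][Y])
    (hH : Irreducible H) (h0 : H ∣ shiftPoly E s μ) (h1 : H ∣ derivX (shiftPoly E s μ)) :
    ¬ H ∣ derivative (shiftPoly E s μ) := by
  intro h2
  have hs' : ∀ i, s i ≠ 0 := fun i h ↦ hs i (by simp [h])
  refine infinite_torus_zeros hH (fun h ↦ not_X_dvd_shiftPoly hs' hμ (h.trans h0))
    (fun h ↦ not_Y_dvd_shiftPoly hs' hμ (h.trans h0))
    ((finite_preimage_powMap hs' (finite_singular hE)).subset fun z hz ↦ ?_)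
  have hdvd : ∀ {P : K[X][Y]}, H ∣ P → P.evalEval (z 0 : K) (z 1 : K) = 0 := fun h ↦ by
    have := evalEval_dvd (z 0 : K) (z 1 : K) h
    rw [show H.evalEval (z 0 : K) (z 1 : K) = 0 from hz] at this
    exact zero_dvd_iff.1 this
  have e0 := evalEval_shiftPoly hμ.1 z
  rw [hdvd h0, eq_comm, mul_eq_zero] at e0
  have e0' := e0.resolve_left (Units.ne_zero _)
  have e1 := evalEval_derivX_shiftPoly hμ.1 z
  rw [hdvd h1, mul_zero, eq_comm, mul_eq_zero, e0', mul_zero, sub_zero, mul_eq_zero] at e1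
  have e2 := evalEval_derivative_shiftPoly hμ.1 z
  rw [hdvd h2, mul_zero, eq_comm, mul_eq_zero, e0', mul_zero, sub_zero, mul_eq_zero] at e2
  refine ⟨e0', fun i ↦ ?_⟩
  fin_cases i
  · exact (e1.resolve_left (Units.ne_zero _)).resolve_left (hs 0)
  · exact (e2.resolve_left (Units.ne_zero _)).resolve_left (hs 1)

end Singular

/-! ### The degree of a pull-back and the Newton polygon -/

section Support

variable {K : Type*} [Field K]

theorem supportFn_newtonPolygon {E : Laurent K 2} {w : Fin 2 → ℝ} {M : ℝ}
    (hle : ∀ m ∈ E.coeff.support, w 0 * m 0 + w 1 * m 1 ≤ M)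
    (heq : ∃ m ∈ E.coeff.support, w 0 * m 0 + w 1 * m 1 = M) :
    supportFn (newtonPolygon E) w = M := by
  refine IsGreatest.csSup_eq ⟨?_, ?_⟩
  · obtain ⟨m, hm, h⟩ := heq
    exact ⟨_, subset_convexHull ℝ _ ⟨m, hm, rfl⟩, by simpa [dotProduct, Fin.sum_univ_two] using h⟩
  · rintro _ ⟨u, hu, rfl⟩
    have hconv : Convex ℝ {u : Fin 2 → ℝ | w ⬝ᵥ u ≤ M} :=
      convex_halfSpace_le ⟨dotProduct_add w, fun c x ↦ dotProduct_smul c w x⟩ M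
    refine convexHull_min ?_ hconv hu
    rintro _ ⟨m, hm, rfl⟩
    simpa [dotProduct, Fin.sum_univ_two] using hle m hm

/-- The degree of the pull-back of an irreducible curve under `powMap s`, in terms of the Newton
polygon of the curve. -/
theorem exists_curveHasDegree_preimage [IsAlgClosed K] {E : Laurent K 2} (hE : Irreducible E)
    {s : Fin 2 → ℤ} (hs : ∀ i, (s i : K) ≠ 0) :
    ∃ D : ℕ, CurveHasDegree (powMap s ⁻¹' zeroLocus {E}) D ∧
      supportFn (newtonPolygon E) ![(s 0 : ℝ), (s 1 : ℝ)] +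
        supportFn (newtonPolygon E) ![-(s 0 : ℝ), 0] +
        supportFn (newtonPolygon E) ![0, -(s 1 : ℝ)] = (D : ℝ) := by
  have hs' : ∀ i, s i ≠ 0 := fun i h ↦ hs i (by simp [h])
  obtain ⟨μ, hμ⟩ := exists_isMinExponent hE.ne_zero s
  obtain ⟨m₀, hm₀, -⟩ := hμ.2 0
  obtain ⟨M, hM, hmax⟩ := Finset.exists_max_image E.coeff.support
    (fun m ↦ s 0 * m 0 + s 1 * m 1) ⟨m₀, hm₀⟩
  have hM0 := hμ.1 M hM 0
  have hM1 := hμ.1 M hM 1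
  set D := (s 0 * M 0 + s 1 * M 1 - μ 0 - μ 1).toNat with hD
  have hDcast : (D : ℤ) = s 0 * M 0 + s 1 * M 1 - μ 0 - μ 1 := Int.toNat_of_nonneg (by omega)
  refine ⟨D, ?_, ?_⟩
  · have hdeg : TotalDegreeLE (shiftPoly E s μ) D := by
      intro i j hij
      obtain ⟨m, hm, rfl, rfl⟩ := exists_of_coeff_shiftPoly_ne_zero hij
      have h0 := hμ.1 m hm 0
      have h1 := hμ.1 m hm 1
      have h2 := hmax m hm
      omega
    have htop : ∃ j ≤ D, ((shiftPoly E s μ).coeff j).coeff (D - j) ≠ 0 := by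
      refine ⟨(s 1 * M 1 - μ 1).toNat, by omega, ?_⟩
      rw [show D - (s 1 * M 1 - μ 1).toNat = (s 0 * M 0 - μ 0).toNat by omega,
        coeff_shiftPoly hs' hμ.1 hM]
      exact Finsupp.mem_support_iff.1 hM
    have := curveHasDegree_of_totalDegree hdeg htop (no_singular_component hE hs hμ)
      (not_X_dvd_shiftPoly hs' hμ) (not_Y_dvd_shiftPoly hs' hμ)
    convert this using 1
    ext z
    simp only [Set.mem_preimage, zeroLocus, Set.mem_singleton_iff, forall_eq, laurentEval_eq,
      Set.mem_ofPred_eq, evalEval_shiftPoly hμ.1, mul_eq_zero, Units.ne_zero, false_or]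
  · obtain ⟨m₁, hm₁, h₁⟩ := hμ.2 0
    obtain ⟨m₂, hm₂, h₂⟩ := hμ.2 1
    rw [supportFn_newtonPolygon (M := s 0 * M 0 + s 1 * M 1),
      supportFn_newtonPolygon (M := -μ 0), supportFn_newtonPolygon (M := -μ 1)]
    · have : (D : ℝ) = ((D : ℤ) : ℝ) := by simp
      rw [this, hDcast]
      push_cast
      ring
    · intro m hm
      have := hμ.1 m hm 1
      have : (μ 1 : ℝ) ≤ s 1 * m 1 := by exact_mod_cast this
      simpa using this
    · exact ⟨m₂, hm₂, by simp [h₂]⟩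
    · intro m hm
      have := hμ.1 m hm 0
      have : (μ 0 : ℝ) ≤ s 0 * m 0 := by exact_mod_cast this
      simpa using this
    · exact ⟨m₁, hm₁, by simp [h₁]⟩
    · intro m hm
      have := hmax m hm
      simpa using (by exact_mod_cast this :
        (s 0 * m 0 + s 1 * m 1 : ℝ) ≤ s 0 * M 0 + s 1 * M 1)
    · exact ⟨M, hM, by simp⟩

end Support

/-! ### Rational parametrizations -/

section RationalFunctions

variable {K : Type*} [Field K]

theorem not_eval_num_and_denom_eq_zero (f : RatFunc K) (t : K) :
    ¬ (f.num.eval t = 0 ∧ f.denom.eval t = 0) := by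
  rintro ⟨h1, h2⟩
  obtain ⟨a, b, hab⟩ := f.isCoprime_num_denom
  have := congrArg (eval t) hab
  simp [h1, h2] at this

theorem isUnitAt_of_eval_num_eq {f : RatFunc K} {t x : K} (hx : x ≠ 0)
    (h : f.num.eval t = x * f.denom.eval t) : IsUnitAt f t := by
  have h1 : f.denom.eval t ≠ 0 := fun h0 ↦
    not_eval_num_and_denom_eq_zero f t ⟨by rw [h, h0, mul_zero], h0⟩
  exact ⟨by rw [h]; exact mul_ne_zero hx h1, h1⟩

theorem exists_eq_C_of_linear_relation {f : RatFunc K} {a b : K} (hab : ¬ (a = 0 ∧ b = 0))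
    (h : C a * f.denom - C b * f.num = 0) : ∃ c, f = RatFunc.C c := by
  by_cases hb : b = 0
  · have ha : a ≠ 0 := fun ha ↦ hab ⟨ha, hb⟩
    simp [hb, ha, f.denom_ne_zero] at h
  · refine ⟨a / b, ?_⟩
    have h1 : f.num = C (a / b) * f.denom := by
      have h2 : C b * f.num = C b * (C (a / b) * f.denom) := by
        rw [← mul_assoc, ← C_mul, mul_div_cancel₀ _ hb]
        linear_combination -h
      exact mul_left_cancel₀ (C_ne_zero.2 hb) h2
    have hd : algebraMap K[X] (RatFunc K) f.denom ≠ 0 :=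
      RatFunc.algebraMap_ne_zero f.denom_ne_zero
    rw [← f.num_div_denom, h1, map_mul, mul_div_assoc]
    rw [RatFunc.algebraMap_C, div_self hd, mul_one]

theorem subsingleton_linear_eq {a b : K} (hab : ¬ (a = 0 ∧ b = 0)) :
    {x : K | a = x * b}.Subsingleton := by
  intro x hx y hy
  simp only [Set.mem_ofPred_eq] at hx hy
  by_cases hb : b = 0
  · exact absurd ⟨by simpa [hb] using hx, hb⟩ hab
  · exact mul_right_cancel₀ hb (hx.symm.trans hy)

variable {f g : RatFunc K}

theorem unitValue_eq_iff {t : K} (h : IsUnitAt f t) (x : Kˣ) :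
    unitValue f t h = x ↔ f.num.eval t = x * f.denom.eval t := by
  rw [← Units.val_inj, unitValue, Units.val_mk0, div_eq_iff h.2]

theorem rho_eq_iff (t : RhoDomain f g) (q : Torus K 2) :
    rho f g t = q ↔ f.num.eval (t.1 : K) = q 0 * f.denom.eval (t.1 : K) ∧
      g.num.eval (t.1 : K) = q 1 * g.denom.eval (t.1 : K) := by
  rw [← unitValue_eq_iff t.2.1, ← unitValue_eq_iff t.2.2, funext_iff, Fin.forall_fin_two]
  rfl

theorem rhoDomain_val_injective : Function.Injective fun t : RhoDomain f g ↦ (t.1 : K) :=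
  Units.val_injective.comp Subtype.val_injective

theorem exists_rho_eq {t : K} (ht : t ≠ 0) {q : Torus K 2}
    (h1 : f.num.eval t = q 0 * f.denom.eval t) (h2 : g.num.eval t = q 1 * g.denom.eval t) :
    ∃ u : RhoDomain f g, (u.1 : K) = t ∧ rho f g u = q :=
  ⟨⟨Units.mk0 t ht, isUnitAt_of_eval_num_eq (q 0).ne_zero h1,
    isUnitAt_of_eval_num_eq (q 1).ne_zero h2⟩, rfl, (rho_eq_iff _ q).2 ⟨h1, h2⟩⟩

theorem infinite_rhoDomain [Infinite K] (hf : f ≠ 0) (hg : g ≠ 0) : Infinite (RhoDomain f g) := by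
  have h0 : f.num * f.denom * (g.num * g.denom) * X ≠ 0 := by
    simp [f.denom_ne_zero, g.denom_ne_zero, RatFunc.num_ne_zero hf, RatFunc.num_ne_zero hg]
  have h1 : (Set.range fun t : RhoDomain f g ↦ (t.1 : K)).Infinite := by
    refine (finite_eval_eq_zero h0).infinite_compl.mono fun t ht ↦ ?_
    simp only [Set.mem_compl_iff, Set.mem_ofPred_eq, eval_mul, eval_X, mul_eq_zero, not_or] at ht
    exact ⟨⟨Units.mk0 t ht.2, ht.1.1, ht.1.2⟩, rfl⟩
  exact Set.infinite_range_iff rhoDomain_val_injective |>.1 h1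

theorem finite_rhoDomain_eval {N : K[X]} (hN : N ≠ 0) :
    {t : RhoDomain f g | N.eval (t.1 : K) = 0}.Finite :=
  (finite_eval_eq_zero hN).preimage rhoDomain_val_injective.injOn

/-- Substituting `f` and `g` into a polynomial and clearing denominators. -/
theorem exists_clear_denominators (F : K[X][Y]) : ∃ N c : K[X],
    ∀ t : RhoDomain f g, c.eval (t.1 : K) ≠ 0 ∧ N.eval (t.1 : K) =
      c.eval (t.1 : K) * F.evalEval (rho f g t 0 : K) (rho f g t 1 : K) := by
  induction F using Polynomial.induction_on' with
  | add p q hp hq =>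
    obtain ⟨N₁, c₁, h₁⟩ := hp
    obtain ⟨N₂, c₂, h₂⟩ := hq
    refine ⟨N₁ * c₂ + N₂ * c₁, c₁ * c₂, fun t ↦ ⟨?_, ?_⟩⟩
    · rw [eval_mul]; exact mul_ne_zero (h₁ t).1 (h₂ t).1
    · simp only [eval_add, eval_mul, (h₁ t).2, (h₂ t).2, evalEval_add]; ring
  | monomial j r =>
    induction r using Polynomial.induction_on' with
    | add p q hp hq =>
      obtain ⟨N₁, c₁, h₁⟩ := hp
      obtain ⟨N₂, c₂, h₂⟩ := hq
      refine ⟨N₁ * c₂ + N₂ * c₁, c₁ * c₂, fun t ↦ ⟨?_, ?_⟩⟩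
      · rw [eval_mul]; exact mul_ne_zero (h₁ t).1 (h₂ t).1
      · simp only [eval_add, eval_mul, (h₁ t).2, (h₂ t).2, map_add, evalEval_add]; ring
    | monomial i a =>
      refine ⟨C a * f.num ^ i * g.num ^ j, f.denom ^ i * g.denom ^ j, fun t ↦ ⟨?_, ?_⟩⟩
      · simp [t.2.1.2, t.2.2.2]
      · obtain ⟨h1, h2⟩ := (rho_eq_iff t _).1 rfl
        rw [evalEval_monomial_monomial]
        simp only [eval_mul, eval_pow, eval_C, h1, h2]
        ring

theorem evalEval_rho_eq_zero_of_infinite {F : K[X][Y]}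
    (h : {t : RhoDomain f g | F.evalEval (rho f g t 0 : K) (rho f g t 1 : K) = 0}.Infinite)
    (t : RhoDomain f g) : F.evalEval (rho f g t 0 : K) (rho f g t 1 : K) = 0 := by
  obtain ⟨N, c, hN⟩ := exists_clear_denominators (f := f) (g := g) F
  have hN0 : N = 0 := by
    by_contra hne
    refine h ((finite_rhoDomain_eval hne).subset fun t ht ↦ ?_)
    rw [Set.mem_ofPred_eq, (hN t).2, show F.evalEval _ _ = 0 from ht, mul_zero]
  have h1 := (hN t).2
  rw [hN0, eval_zero, eq_comm, mul_eq_zero] at h1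
  exact h1.resolve_left (hN t).1

theorem exists_bivariate_zero_iff (F : Laurent K 2) : ∃ P : K[X][Y], ∀ z : Torus K 2,
    evalHom z F = 0 ↔ P.evalEval (z 0 : K) (z 1 : K) = 0 := by
  obtain ⟨a, b, P, hP⟩ := exists_ofBivariate_eq F
  refine ⟨P, fun z ↦ ?_⟩
  have := congrArg (evalHom z) hP
  rw [map_mul, evalHom_ofBivariate, evalHom_ofBivariate] at this
  rw [this, mul_eq_zero]
  simp [evalEval_mul, evalEval_pow, evalEval_C]

theorem evalHom_rho_eq_zero_of_infinite {F : Laurent K 2}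
    (h : {t : RhoDomain f g | evalHom (rho f g t) F = 0}.Infinite) (t : RhoDomain f g) :
    evalHom (rho f g t) F = 0 := by
  obtain ⟨P, hP⟩ := exists_bivariate_zero_iff F
  simp only [hP] at h ⊢
  exact evalEval_rho_eq_zero_of_infinite h t

variable (hfg : ¬ ∃ a b : K, f = RatFunc.C a ∧ g = RatFunc.C b)
include hfg

theorem linear_relation_ne_zero {a b a' b' : K} (hab : ¬ (a = 0 ∧ b = 0))
    (hab' : ¬ (a' = 0 ∧ b' = 0)) :
    C a * f.denom - C b * f.num ≠ 0 ∨ C a' * g.denom - C b' * g.num ≠ 0 := by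
  by_contra! h
  obtain ⟨c, hc⟩ := exists_eq_C_of_linear_relation hab h.1
  obtain ⟨c', hc'⟩ := exists_eq_C_of_linear_relation hab' h.2
  exact hfg ⟨c, c', hc, hc'⟩

theorem finite_linear_relation {a b a' b' : K} (hab : ¬ (a = 0 ∧ b = 0))
    (hab' : ¬ (a' = 0 ∧ b' = 0)) :
    {t : K | (C a * f.denom - C b * f.num).eval t = 0 ∧
      (C a' * g.denom - C b' * g.num).eval t = 0}.Finite := by
  rcases linear_relation_ne_zero hfg hab hab' with h | h
  · exact (finite_eval_eq_zero h).subset fun t ht ↦ ht.1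
  · exact (finite_eval_eq_zero h).subset fun t ht ↦ ht.2

theorem finite_fiber_rho (q : Torus K 2) : (rho f g ⁻¹' {q}).Finite := by
  refine ((finite_linear_relation hfg (a := q 0) (b := 1) (a' := q 1) (b' := 1)
    (by simp) (by simp)).preimage (rhoDomain_val_injective (f := f) (g := g)).injOn).subset
      fun t ht ↦ ?_
  obtain ⟨h1, h2⟩ := (rho_eq_iff t q).1 ht
  simp [h1, h2]

theorem infinite_range_rho [Infinite K] (hf : f ≠ 0) (hg : g ≠ 0) :
    (Set.range (rho f g)).Infinite := fun h ↦ by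
  have := infinite_rhoDomain hf hg
  refine Set.infinite_univ (α := RhoDomain f g) ?_
  rw [← Set.preimage_range (rho f g)]
  exact h.preimage' fun q _ ↦ finite_fiber_rho hfg q

end RationalFunctions

/-! ### The image of a parametrization and its generic fibre -/

section Elimination

variable {K : Type*} [Field K]

/-- The resultant with respect to `t` of `f.num - x f.denom` and `g.num - y g.denom`, formed with
the formal degrees `deg f` and `deg g`. -/
noncomputable def elimination (f g : RatFunc K) : K[X][Y] :=
  resultant (f.num.map (algebraMap K K[X][Y]) - C (C X) * f.denom.map (algebraMap K K[X][Y]))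
    (g.num.map (algebraMap K K[X][Y]) - C X * g.denom.map (algebraMap K K[X][Y]))
    (max f.num.natDegree f.denom.natDegree) (max g.num.natDegree g.denom.natDegree)

theorem evalEval_elimination (f g : RatFunc K) (x y : K) : (elimination f g).evalEval x y =
    (f.num - C x * f.denom).resultant (g.num - C y * g.denom)
      (max f.num.natDegree f.denom.natDegree) (max g.num.natDegree g.denom.natDegree) := by
  have h : ∀ p : K[X], (p.map (algebraMap K K[X][Y])).map (evalEvalRingHom x y) = p := fun p ↦ by
    rw [Polynomial.map_map]
    convert! Polynomial.map_id
    ext a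
    simp [coe_algebraMap_eq_CC]
  rw [elimination, ← coe_evalEvalRingHom, ← resultant_map_map]
  congr 1 <;> simp [h]

theorem natDegree_sub_C_mul_le (p q : K[X]) (x : K) :
    (p - C x * q).natDegree ≤ max p.natDegree q.natDegree :=
  (natDegree_sub_le _ _).trans (max_le_max le_rfl (natDegree_C_mul_le _ _))

theorem top_coeff_ne_zero (f : RatFunc K) :
    ¬ (f.num.coeff (max f.num.natDegree f.denom.natDegree) = 0 ∧
      f.denom.coeff (max f.num.natDegree f.denom.natDegree) = 0) := by
  rintro ⟨h1, h2⟩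
  rcases max_choice f.num.natDegree f.denom.natDegree with h | h
  · rw [h] at h1 h2
    have h3 : f.num = 0 := leadingCoeff_eq_zero.1 h1
    rw [h3, natDegree_zero, coeff_zero_eq_eval_zero] at h2
    exact not_eval_num_and_denom_eq_zero f 0 ⟨by simp [h3], h2⟩
  · rw [h] at h2
    exact f.denom_ne_zero (leadingCoeff_eq_zero.1 h2)

variable {f g : RatFunc K}

/-- The zeros of the resultant are the points of the image of `t ↦ (f(t), g(t))`, with
`t ∈ K ∪ {∞}`. -/
theorem exists_of_evalEval_elimination_eq_zero [IsAlgClosed K] {x y : K}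
    (h : (elimination f g).evalEval x y = 0) :
    (∃ t, f.num.eval t = x * f.denom.eval t ∧ g.num.eval t = y * g.denom.eval t) ∨
      (f.num.coeff (max f.num.natDegree f.denom.natDegree) =
          x * f.denom.coeff (max f.num.natDegree f.denom.natDegree) ∧
        g.num.coeff (max g.num.natDegree g.denom.natDegree) =
          y * g.denom.coeff (max g.num.natDegree g.denom.natDegree)) := by
  rw [evalEval_elimination] at h
  refine (exists_common_root_of_resultant_eq_zero (natDegree_sub_C_mul_le _ _ _)
    (natDegree_sub_C_mul_le _ _ _) h).imp (fun ⟨t, h1, h2⟩ ↦ ⟨t, ?_, ?_⟩) fun ⟨h1, h2⟩ ↦ ⟨?_, ?_⟩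
  · simpa [sub_eq_zero] using h1
  · simpa [sub_eq_zero] using h2
  · simpa [sub_eq_zero] using h1
  · simpa [sub_eq_zero] using h2

theorem elimination_ne_zero [IsAlgClosed K] : elimination f g ≠ 0 := by
  intro h0
  have hzero : ∀ x y : K, (elimination f g).evalEval x y = 0 := fun x y ↦ by
    rw [h0, evalEval_zero]
  obtain ⟨x, hx⟩ := (subsingleton_linear_eq (top_coeff_ne_zero f)).finite.infinite_compl.nonempty
  simp only [Set.mem_compl_iff, Set.mem_ofPred_eq] at hx
  have hne : f.num - C x * f.denom ≠ 0 := fun h ↦ hx (by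
    have := congrArg (fun p ↦ p.coeff (max f.num.natDegree f.denom.natDegree)) h
    simpa [sub_eq_zero] using this)
  obtain ⟨y, hy⟩ := ((finite_eval_eq_zero hne).biUnion
    (t := fun t ↦ {y | g.num.eval t = y * g.denom.eval t}) fun t _ ↦
      (subsingleton_linear_eq (not_eval_num_and_denom_eq_zero g t)).finite).infinite_compl.nonempty
  simp only [Set.mem_compl_iff, Set.mem_iUnion, not_exists] at hy
  rcases exists_of_evalEval_elimination_eq_zero (hzero x y) with ⟨t, h1, h2⟩ | ⟨h1, -⟩
  · exact hy t (by simp [h1]) h2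
  · exact hx h1

variable (hfg : ¬ ∃ a b : K, f = RatFunc.C a ∧ g = RatFunc.C b)
include hfg

theorem evalEval_elimination_rho (t : RhoDomain f g) :
    (elimination f g).evalEval (rho f g t 0 : K) (rho f g t 1 : K) = 0 := by
  obtain ⟨h1, h2⟩ := (rho_eq_iff t _).1 rfl
  rw [evalEval_elimination]
  refine resultant_eq_zero_of_common_root (natDegree_sub_C_mul_le _ _ _)
    (natDegree_sub_C_mul_le _ _ _) ?_ (t := (t.1 : K)) (by simp [h1]) (by simp [h2])
  by_contra! h
  have key : ∀ {f : RatFunc K}, max f.num.natDegree f.denom.natDegree = 0 →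
      ∃ c, f = RatFunc.C c := by
    intro f hf
    refine exists_eq_C_of_linear_relation (a := f.num.coeff 0) (b := f.denom.coeff 0) ?_ ?_
    · simpa [coeff_zero_eq_eval_zero] using not_eval_num_and_denom_eq_zero f 0
    · have h1 := eq_C_of_natDegree_eq_zero (Nat.le_zero.1 ((le_max_left _ _).trans hf.le))
      have h2 := eq_C_of_natDegree_eq_zero (Nat.le_zero.1 ((le_max_right _ _).trans hf.le))
      rw [← h1, ← h2]
      ring
  obtain ⟨a, ha⟩ := key h.1
  obtain ⟨b, hb⟩ := key h.2
  exact hfg ⟨a, b, ha, hb⟩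

variable [IsAlgClosed K]

/-- The image of `ρ` is cofinite in the curve `C`: the only other points which `C` can have are
the limits of `ρ(t)` for `t → 0` and `t → ∞`. -/
theorem finite_curve_diff_range : (curve f g \ Set.range (rho f g)).Finite := by
  have hsub : ∀ {a b c d : K}, ¬ (a = 0 ∧ b = 0) → ¬ (c = 0 ∧ d = 0) →
      {z : Torus K 2 | a = z 0 * b ∧ c = z 1 * d}.Finite := by
    intro a b c d h h'
    refine Set.Subsingleton.finite fun z hz w hw ↦ ?_
    ext i
    fin_cases i
    · exact subsingleton_linear_eq h hz.1 hw.1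
    · exact subsingleton_linear_eq h' hz.2 hw.2
  refine ((hsub (not_eval_num_and_denom_eq_zero f 0) (not_eval_num_and_denom_eq_zero g 0)).union
    (hsub (top_coeff_ne_zero f) (top_coeff_ne_zero g))).subset fun z hz ↦ ?_
  have h0 := mem_zariskiClosure.1 hz.1 (ofBivariate (elimination f g)) (by
    rintro _ ⟨t, rfl⟩
    rw [evalHom_ofBivariate, evalEval_elimination_rho hfg])
  rw [evalHom_ofBivariate] at h0
  rcases exists_of_evalEval_elimination_eq_zero h0 with ⟨t, h1, h2⟩ | h
  · by_cases ht : t = 0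
    · subst ht
      exact Or.inl ⟨h1, h2⟩
    · obtain ⟨u, -, hu⟩ := exists_rho_eq ht h1 h2
      exact absurd ⟨u, hu⟩ hz.2
  · exact Or.inr h

/-- The fibre of `ρ` through `t` has the same number of points for all but finitely many `t`. -/
theorem exists_generic_fiber_card_rho : ∃ d : ℕ,
    {s : RhoDomain f g | (rho f g ⁻¹' {rho f g s}).encard ≠ d}.Finite := by
  let A : RatFunc K → K[X][Y] := fun f ↦ f.num.map C * C f.denom - C f.num * f.denom.map C
  have hA : ∀ f s t, (A f).evalEval s t =
      f.num.eval t * f.denom.eval s - f.num.eval s * f.denom.eval t := fun f s t ↦ by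
    simp [A, evalEval_C, evalEval_map_C, evalEval_sub, evalEval_mul]
  have hAlin : ∀ f s t, (A f).evalEval s t =
      (C (f.num.eval t) * f.denom - C (f.denom.eval t) * f.num).eval s := fun f s t ↦ by
    rw [hA]; simp; ring
  -- for fixed `t` there are only finitely many `s` with `f(s) = f(t)` and `g(s) = g(t)`
  have hfin : ∀ t : K, {s : K | (A f).evalEval s t = 0 ∧ (A g).evalEval s t = 0}.Finite := by
    intro t
    simp only [hAlin]
    exact finite_linear_relation hfg (not_eval_num_and_denom_eq_zero f t)
      (not_eval_num_and_denom_eq_zero g t)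
  have hne : A f ≠ 0 ∨ A g ≠ 0 := by
    by_contra! h
    refine Set.infinite_univ (α := K) ((hfin 0).subset fun s _ ↦ ?_)
    simp [h.1, h.2]
  obtain ⟨A', B', D, hrel, hA', hB'⟩ : ∃ A' B' D : K[X][Y], IsRelPrime A' B' ∧
      D * A' = A f ∧ D * B' = A g := by
    rcases hne with h | h
    · exact UniqueFactorizationMonoid.exists_reduced_factors _ h _
    · exact UniqueFactorizationMonoid.exists_reduced_factors' _ _ h
  have hD : D ≠ 0 := by
    rintro rfl
    rw [zero_mul] at hA' hB'
    exact hne.elim (fun h ↦ h hA'.symm) fun h ↦ h hB'.symm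
  obtain ⟨d, hd⟩ := exists_generic_fiber_card hD
  refine ⟨d, (((hd.union (finite_fst_common_zeros hrel)).union (hfin 0)).preimage
    (rhoDomain_val_injective (f := f) (g := g)).injOn).subset fun s hs ↦ ?_⟩
  by_contra hc
  simp only [Set.mem_preimage, Set.mem_union, Set.mem_ofPred_eq, not_or, not_not, not_exists]
    at hc
  obtain ⟨⟨hc1, hc2⟩, hc3⟩ := hc
  have hzero : ∀ t, D.evalEval (s.1 : K) t = 0 ↔
      (A f).evalEval (s.1 : K) t = 0 ∧ (A g).evalEval (s.1 : K) t = 0 := fun t ↦ by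
    rw [← hA', ← hB', evalEval_mul, evalEval_mul, mul_eq_zero, mul_eq_zero, ← or_and_left]
    exact ⟨Or.inl, fun h ↦ h.resolve_right (hc2 t)⟩
  refine hs ?_
  rw [← hc1, ← (rhoDomain_val_injective (f := f) (g := g)).encard_image]
  congr 1
  obtain ⟨h1, h2⟩ := (rho_eq_iff s _).1 rfl
  have hiff : ∀ t, D.evalEval (s.1 : K) t = 0 ↔
      f.num.eval t = rho f g s 0 * f.denom.eval t ∧
        g.num.eval t = rho f g s 1 * g.denom.eval t := fun t ↦ by
    rw [hzero, hA, hA, h1, h2]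
    have e1 : f.num.eval t * f.denom.eval (s.1 : K) -
        rho f g s 0 * f.denom.eval (s.1 : K) * f.denom.eval t =
        f.denom.eval (s.1 : K) * (f.num.eval t - rho f g s 0 * f.denom.eval t) := by ring
    have e2 : g.num.eval t * g.denom.eval (s.1 : K) -
        rho f g s 1 * g.denom.eval (s.1 : K) * g.denom.eval t =
        g.denom.eval (s.1 : K) * (g.num.eval t - rho f g s 1 * g.denom.eval t) := by ring
    rw [e1, e2, mul_eq_zero, mul_eq_zero, sub_eq_zero, sub_eq_zero]
    simp [s.2.1.2, s.2.2.2]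
  ext t
  constructor
  · rintro ⟨u, hu, rfl⟩
    exact (hiff _).2 ((rho_eq_iff u _).1 hu)
  · intro ht
    have ht0 : t ≠ 0 := by
      rintro rfl
      exact hc3 ((hzero 0).1 ht)
    obtain ⟨h1, h2⟩ := (hiff t).1 ht
    obtain ⟨u, rfl, hu⟩ := exists_rho_eq ht0 h1 h2
    exact ⟨u, hu, rfl⟩

/-- Above the complement of a finite subset of `C` all fibres of `ρ` have the same number of
points. -/
theorem exists_generic_fibers : ∃ (d : ℕ) (W : Set (Torus K 2)), W.Finite ∧
    ∀ q ∈ curve f g \ W, (rho f g ⁻¹' {q}).encard = d := by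
  obtain ⟨d, hd⟩ := exists_generic_fiber_card_rho hfg
  refine ⟨d, _, (finite_curve_diff_range hfg).union (hd.image (rho f g)), fun q hq ↦ ?_⟩
  simp only [Set.mem_sdiff, Set.mem_union, not_or, not_and, not_not] at hq
  obtain ⟨s, rfl⟩ := hq.2.1 hq.1
  by_contra hne
  exact hq.2.2 ⟨s, hne, rfl⟩

variable (hf : f ≠ 0) (hg : g ≠ 0)
include hf hg

theorem exists_irreducible_vanishing : ∃ P : K[X][Y], Irreducible P ∧
    ∀ t : RhoDomain f g, P.evalEval (rho f g t 0 : K) (rho f g t 1 : K) = 0 := by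
  have := infinite_rhoDomain hf hg
  have key : ∀ R : K[X][Y], R ≠ 0 →
      (∀ t : RhoDomain f g, R.evalEval (rho f g t 0 : K) (rho f g t 1 : K) = 0) →
      ∃ P : K[X][Y], Irreducible P ∧
        ∀ t : RhoDomain f g, P.evalEval (rho f g t 0 : K) (rho f g t 1 : K) = 0 := by
    intro R
    induction R using UniqueFactorizationMonoid.induction_on_prime with
    | h₁ => exact fun h ↦ absurd rfl h
    | h₂ x hx =>
      intro _ h
      obtain ⟨t⟩ := Infinite.nonempty (RhoDomain f g)
      have h1 := hx.map (evalEvalRingHom (rho f g t 0 : K) (rho f g t 1 : K))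
      rw [coe_evalEvalRingHom, h t] at h1
      exact absurd h1 not_isUnit_zero
    | h₃ a p ha hp ih =>
      intro _ h
      by_cases hpinf : {t : RhoDomain f g |
          p.evalEval (rho f g t 0 : K) (rho f g t 1 : K) = 0}.Infinite
      · exact ⟨p, hp.irreducible, evalEval_rho_eq_zero_of_infinite hpinf⟩
      · refine ih ha (evalEval_rho_eq_zero_of_infinite
          ((Set.not_infinite.1 hpinf).infinite_compl.mono fun t ht ↦ ?_))
        have h1 := h t
        rw [evalEval_mul, mul_eq_zero] at h1
        exact h1.resolve_left ht
  exact key _ elimination_ne_zero (evalEval_elimination_rho hfg)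

theorem exists_isDefiningEquation : ∃ E : Laurent K 2, IsDefiningEquation E (curve f g) := by
  obtain ⟨P, hP, hPrho⟩ := exists_irreducible_vanishing hfg hf hg
  have := infinite_rhoDomain hf hg
  obtain ⟨t₀⟩ := Infinite.nonempty (RhoDomain f g)
  refine ⟨ofBivariate P, irreducible_ofBivariate hP (hPrho t₀),
    Set.Subset.antisymm (fun z hz ↦ ?_) ?_⟩
  · simp only [zeroLocus, Set.mem_singleton_iff, forall_eq, Set.mem_ofPred_eq, laurentEval_eq,
      evalHom_ofBivariate] at hz
    refine mem_zariskiClosure.2 fun F hF ↦ ?_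
    obtain ⟨Q, hQ⟩ := exists_bivariate_zero_iff F
    -- otherwise the curves `P = 0` and `Q = 0` would meet in finitely many points only
    have hdvd : P ∣ Q := by
      by_contra hnd
      refine infinite_range_rho hfg hf hg
        ((finite_torus_zeros (hP.isRelPrime_iff_not_dvd.2 hnd)).subset ?_)
      rintro _ ⟨t, rfl⟩
      exact ⟨hPrho t, (hQ _).1 (hF _ ⟨t, rfl⟩)⟩
    rw [hQ]
    have := evalEval_dvd (z 0 : K) (z 1 : K) hdvd
    rw [hz] at this
    exact zero_dvd_iff.1 this
  · refine zariskiClosure_subset ⟨_, rfl⟩ ?_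
    rintro _ ⟨t, rfl⟩
    simp only [zeroLocus, Set.mem_singleton_iff, forall_eq, Set.mem_ofPred_eq, laurentEval_eq,
      evalHom_ofBivariate, hPrho t]

theorem isDenseOpenIn_curve_diff {W : Set (Torus K 2)} (hW : W.Finite) :
    IsDenseOpenIn (curve f g \ W) (curve f g) := by
  refine ⟨⟨W, isZariskiClosed_of_finite hW, rfl⟩,
    zariskiClosure_subset (isZariskiClosed_zariskiClosure _) ?_⟩
  rintro _ ⟨t, rfl⟩
  refine mem_zariskiClosure.2 fun F hF ↦ evalHom_rho_eq_zero_of_infinite ?_ t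
  have := infinite_rhoDomain hf hg
  refine (hW.preimage' fun q _ ↦ finite_fiber_rho hfg q).infinite_compl.mono fun u hu ↦ ?_
  exact hF _ ⟨subset_zariskiClosure _ ⟨u, rfl⟩, hu⟩

end Elimination

/-! ### The curves in the cover -/

section Cover

variable {K : Type*} [Field K] {f g : RatFunc K} {s₁ s₂ : ℤ}

theorem powMap_proj_eq_iff (z : Torus K 3) (q : Torus K 2) :
    powMap ![s₁, s₂] (proj z) = q ↔ z 1 ^ s₁ = q 0 ∧ z 2 ^ s₂ = q 1 := by
  rw [funext_iff, Fin.forall_fin_two]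
  rfl

/-- `G(σ)` has no further points: the equations `x ^ σ₁ * f.denom(t) = f.num(t)` and
`y ^ σ₂ * g.denom(t) = g.num(t)` already force `t` to lie in the domain of `ρ`. -/
theorem coverGraph_eq : coverGraph f g s₁ s₂ =
    {z | ∃ t : RhoDomain f g, z 0 = t.1 ∧ rho f g t = powMap ![s₁, s₂] (proj z)} := by
  have hset : {z : Torus K 3 | ∃ t : RhoDomain f g, z 0 = t.1 ∧ z 1 ^ s₁ = rho f g t 0 ∧
      z 2 ^ s₂ = rho f g t 1} =
      {z | ∃ t : RhoDomain f g, z 0 = t.1 ∧ rho f g t = powMap ![s₁, s₂] (proj z)} := by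
    ext z
    exact exists_congr fun t ↦ and_congr_right fun _ ↦ by rw [← powMap_proj_eq_iff, eq_comm]
  rw [coverGraph, hset]
  refine Set.Subset.antisymm (fun z hz ↦ ?_) (subset_zariskiClosure _)
  let T : Laurent K 3 := AddMonoidAlgebra.single (Pi.single 0 1) 1
  let G : RatFunc K → Fin 3 → ℤ → Laurent K 3 := fun f i s ↦
    aeval T f.num - AddMonoidAlgebra.single (Pi.single i s) 1 * aeval T f.denom
  have hT : ∀ (w : Torus K 3) (p : K[X]), evalHom w (aeval T p) = p.eval (w 0 : K) := fun w p ↦ by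
    rw [← aeval_algHom_apply, evalHom_single_single, one_mul, coe_aeval_eq_eval]
  have hG : ∀ (f : RatFunc K) (i : Fin 3) (s : ℤ) (w : Torus K 3), evalHom w (G f i s) = 0 ↔
      f.num.eval (w 0 : K) = ((w i ^ s : Kˣ) : K) * f.denom.eval (w 0 : K) := by
    intro f i s w
    have : ∏ j, w j ^ (Pi.single i s : Fin 3 → ℤ) j = w i ^ s := by
      rw [Finset.prod_eq_single i] <;> simp +contextual
    rw [map_sub, map_mul, hT, hT, evalHom_single, this, one_mul, sub_eq_zero]
  have h1 := (hG f 1 s₁ z).1 (mem_zariskiClosure.1 hz _ fun w ⟨t, ht, hw⟩ ↦ by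
    rw [hG, ht]; exact ((rho_eq_iff t _).1 hw).1)
  have h2 := (hG g 2 s₂ z).1 (mem_zariskiClosure.1 hz _ fun w ⟨t, ht, hw⟩ ↦ by
    rw [hG, ht]; exact ((rho_eq_iff t _).1 hw).2)
  obtain ⟨t, ht, hrho⟩ := exists_rho_eq (z 0).ne_zero (q := powMap ![s₁, s₂] (proj z)) h1 h2
  exact ⟨t, (Units.ext ht).symm, hrho⟩

theorem encard_fiber_proj (q : Torus K 2) :
    ((fun z : coverGraph f g s₁ s₂ ↦ proj (z : Torus K 3)) ⁻¹' {q}).encard =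
      (rho f g ⁻¹' {powMap ![s₁, s₂] q}).encard := by
  have hinj : Set.InjOn (fun z : coverGraph f g s₁ s₂ ↦ z.1 0)
      ((fun z : coverGraph f g s₁ s₂ ↦ proj (z : Torus K 3)) ⁻¹' {q}) := by
    intro z hz w hw hzw
    have h : proj z.1 = proj w.1 := Eq.trans hz (Eq.symm hw)
    ext i
    fin_cases i
    · exact congrArg Units.val hzw
    · exact congrArg Units.val (congrFun h 0)
    · exact congrArg Units.val (congrFun h 1)
  have hinj' : Function.Injective fun u : RhoDomain f g ↦ u.1 := Subtype.val_injective
  rw [← hinj.encard_image, ← hinj'.encard_image (rho f g ⁻¹' {powMap ![s₁, s₂] q})]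
  congr 1
  ext t
  constructor
  · rintro ⟨⟨z, hz⟩, hzq, rfl⟩
    have hz' := hz
    rw [coverGraph_eq] at hz'
    obtain ⟨u, hu, hrho⟩ := hz'
    have hzq' : proj z = q := hzq
    exact ⟨u, by rw [Set.mem_preimage, Set.mem_singleton_iff, ← hzq']; exact hrho, hu.symm⟩
  · rintro ⟨u, hu, rfl⟩
    have hproj : proj ![u.1, q 0, q 1] = q := by
      ext i; fin_cases i <;> rfl
    exact ⟨⟨![u.1, q 0, q 1], by
      rw [coverGraph_eq]
      exact ⟨u, rfl, by rw [hproj]; exact hu⟩⟩, hproj, rfl⟩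

theorem proj_image_coverGraph :
    proj '' coverGraph f g s₁ s₂ = powMap ![s₁, s₂] ⁻¹' Set.range (rho f g) := by
  ext q
  constructor
  · rintro ⟨z, hz, rfl⟩
    rw [coverGraph_eq] at hz
    obtain ⟨t, -, ht⟩ := hz
    exact ⟨t, ht⟩
  · rintro ⟨t, ht⟩
    have hproj : proj ![t.1, q 0, q 1] = q := by
      ext i; fin_cases i <;> rfl
    refine ⟨![t.1, q 0, q 1], ?_, hproj⟩
    rw [coverGraph_eq]
    exact ⟨t, rfl, by rw [hproj]; exact ht⟩

variable [IsAlgClosed K]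

theorem coverCurve_eq (hs : ∀ i, ((![s₁, s₂] : Fin 2 → ℤ) i : K) ≠ 0) :
    coverCurve f g s₁ s₂ = powMap ![s₁, s₂] ⁻¹' curve f g := by
  rw [coverCurve, proj_image_coverGraph, zariskiClosure_preimage_powMap hs, curve]

theorem IsDenseOpenIn.preimage_powMap {n : ℕ} {s : Fin n → ℤ} (hs : ∀ i, (s i : K) ≠ 0)
    {U Z : Set (Torus K n)} (h : IsDenseOpenIn U Z) :
    IsDenseOpenIn (powMap s ⁻¹' U) (powMap s ⁻¹' Z) := by
  obtain ⟨⟨W, hW, rfl⟩, hdense⟩ := h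
  refine ⟨⟨_, hW.preimage_powMap s, Set.preimage_sdiff _ _ _⟩, ?_⟩
  rw [zariskiClosure_preimage_powMap hs]
  exact Set.preimage_mono hdense

end Cover

end RationalCurve

theorem proposition2p1 {K : Type*} [Field K] [IsAlgClosed K] (p : ℕ) [CharP K p]
    (f g : RatFunc K) (hf : f ≠ 0) (hg : g ≠ 0)
    (hfg : ¬ ∃ a b : K, f = RatFunc.C a ∧ g = RatFunc.C b)
    (s₁ s₂ : ℤ) (hs₁ : ¬ (p : ℤ) ∣ s₁) (hs₂ : ¬ (p : ℤ) ∣ s₂) :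
    (∃ d : ℕ, RationalCurve.MapHasDegree (RationalCurve.rho f g) d ∧
      RationalCurve.MapHasDegree
        (fun z : RationalCurve.coverGraph f g s₁ s₂ => RationalCurve.proj (z : RationalCurve.Torus K 3)) d) ∧
    (∃ E : RationalCurve.Laurent K 2,
      RationalCurve.IsDefiningEquation E (RationalCurve.curve f g)) ∧
    (∀ E : RationalCurve.Laurent K 2,
      RationalCurve.IsDefiningEquation E (RationalCurve.curve f g) →
      ∃ D : ℕ, RationalCurve.CurveHasDegree (RationalCurve.coverCurve f g s₁ s₂) D ∧
        RationalCurve.supportFn (RationalCurve.newtonPolygon E) ![(s₁ : ℝ), (s₂ : ℝ)] +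
        RationalCurve.supportFn (RationalCurve.newtonPolygon E) ![-(s₁ : ℝ), 0] +
        RationalCurve.supportFn (RationalCurve.newtonPolygon E) ![0, -(s₂ : ℝ)] = (D : ℝ)) := by
  have hs : ∀ i, ((![s₁, s₂] : Fin 2 → ℤ) i : K) ≠ 0 := by
    intro i
    fin_cases i
    · exact fun h ↦ hs₁ ((CharP.intCast_eq_zero_iff K p s₁).1 h)
    · exact fun h ↦ hs₂ ((CharP.intCast_eq_zero_iff K p s₂).1 h)
  refine ⟨?_, RationalCurve.exists_isDefiningEquation hfg hf hg, fun E ⟨hE, hEC⟩ ↦ ?_⟩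
  · obtain ⟨d, W, hW, hd⟩ := RationalCurve.exists_generic_fibers hfg
    have hU := RationalCurve.isDenseOpenIn_curve_diff hfg hf hg hW
    refine ⟨d, ⟨_, hU, hd⟩, RationalCurve.powMap ![s₁, s₂] ⁻¹' (RationalCurve.curve f g \ W), ?_,
      fun q hq ↦ ?_⟩
    · have h1 : Set.range (fun z : RationalCurve.coverGraph f g s₁ s₂ ↦
          RationalCurve.proj (z : RationalCurve.Torus K 3)) =
          RationalCurve.proj '' RationalCurve.coverGraph f g s₁ s₂ := Set.image_eq_range _ _ |>.symm
      rw [h1]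
      change RationalCurve.IsDenseOpenIn _ (RationalCurve.coverCurve f g s₁ s₂)
      rw [RationalCurve.coverCurve_eq hs]
      exact hU.preimage_powMap hs
    · rw [RationalCurve.encard_fiber_proj]
      exact hd _ hq
  · rw [RationalCurve.coverCurve_eq hs, ← hEC]
    exact RationalCurve.exists_curveHasDegree_preimage hE hs
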